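/- Theorem (Artin–Schreier tower with $\deg g > \deg h$). Let $q$ be a prime power, $n>1$ and $K=\mathbb{F}_{q^n}$. A polynomial $f\in K[t]$ is called $(n,q)$-quasi-symmetric if $f(t)=G(t,t^q,\dots,t^{q^{n-1}})$ for some polynomial $G\in K[X_1,\dots,X_n]$ that is invariant under the cyclic permutation $(1\,2\,\cdots\,n)$ of the variables. For each $i\ge 1$ let $g_i,h_i\in\mathbb{F}_q[t]$ be $(n,q)$-quasi-symmetric polynomials with coefficients in $\mathbb{F}_q$ such that $h_i$ has no zeros in $\mathbb{F}_{q^n}$ and $\deg g_i>\deg h_i$ (for instance $g_i=g$ and $h_i=h$ for all $i$). Let $F_1=K(x_1)$ be a rational function field and, inside some extension field of $F_1$, let $F_{i+1}=F_i(x_{i+1})$ for $i\ge 1$, where $$x_{i+1}^{q^{n-1}}+x_{i+1}^{q^{n-2}}+\dots+x_{i+1}=\frac{g_i(x_i)}{h_i(x_i)}.$$ Let $P_\infty$ be the unique pole of $x_1$ in $F_1$. (1) Every rational place (place of degree one) $P\neq P_\infty$ of $F_1$ splits completely in all steps of the tower: for all $1\le i\le j$ and every place $Q$ of $F_i$ above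 $P$, there are exactly $[F_j:F_i]<\infty$ places of $F_j$ above $Q$. (2) If moreover $\deg g_i=\deg h_i+1$ for all $i\ge 1$, then for every $i\ge 1$ there is exactly one place of $F_i$ above $P_\infty$, and the pole order of $x_i$ at this place is one. -/

import Mathlib

open Polynomial

/-- A place of a field `F` over the constant field `K`, given by its valuation ring:
a valuation ring `O` of `F` with `K ⊆ O` and `O ≠ F`. -/
@[ext]
structure Place (K F : Type*) [Field K] [Field F] [Algebra K F] where
  ring : ValuationSubring F
  algebraMap_mem : ∀ a : K, algebraMap K F a ∈ ring
  ne_top : ring ≠ ⊤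

namespace Place

/-- The map from the constant field to the residue field of a place. -/
noncomputable def residueMap {K F : Type*} [Field K] [Field F] [Algebra K F] (P : Place K F) :
    K →+* IsLocalRing.ResidueField P.ring :=
  (IsLocalRing.residue P.ring).comp
    ((algebraMap K F).codRestrict P.ring.toSubring P.algebraMap_mem)

/-- The degree of a place: the dimension of its residue field over `K`. -/
noncomputable def degree {K F : Type*} [Field K] [Field F] [Algebra K F] (P : Place K F) : ℕ :=
  letI : Algebra K (IsLocalRing.ResidueField P.ring) := P.residueMap.toAlgebra
  Module.finrank K (IsLocalRing.ResidueField P.ring)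

/-- A rational place is a place of degree one. -/
def IsRational {K F : Type*} [Field K] [Field F] [Algebra K F] (P : Place K F) : Prop :=
  P.degree = 1

/-- `z` has a pole at `P`. -/
def IsPole {K F : Type*} [Field K] [Field F] [Algebra K F] (P : Place K F) (z : F) : Prop :=
  z ∉ P.ring

/-- `v_P(z) = m` for the normalized discrete valuation `v_P` of `P`: the valuation ring of `P` is
a discrete valuation ring and `z = u * ϖ ^ m` with a uniformizer `ϖ` and a unit `u` of it. -/
def HasOrd {K F : Type*} [Field K] [Field F] [Algebra K F] (P : Place K F) (z : F) (m : ℤ) :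
    Prop :=
  IsDiscreteValuationRing P.ring ∧
    ∃ ϖ u : P.ring, Irreducible ϖ ∧ IsUnit u ∧ z = (u : F) * (ϖ : F) ^ m

/-- The place `P'` of `F'` lies over the place `P` of `F`, where `F` is embedded in `F'` by `φ`. -/
def LiesOver {K F F' : Type*} [Field K] [Field F] [Field F'] [Algebra K F] [Algebra K F']
    (φ : F →ₐ[K] F') (P' : Place K F') (P : Place K F) : Prop :=
  P'.ring.comap φ.toRingHom = P.ring

/-- The place `P` of `F` splits completely in the finite extension `F'` of `F`:
exactly `[F' : F]` distinct places of `F'` lie over `P`. -/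
def SplitsCompletely {K F F' : Type*} [Field K] [Field F] [Field F'] [Algebra K F] [Algebra K F']
    (φ : F →ₐ[K] F') (P : Place K F) : Prop :=
  letI : Algebra F F' := φ.toRingHom.toAlgebra
  FiniteDimensional F F' ∧ {P' : Place K F' | LiesOver φ P' P}.encard = Module.finrank F F'

end Place

/-- A polynomial in `n` variables is quasi-symmetric if it is fixed by the `n`-cycle
`(1 2 … n)` acting on the variables. -/
def IsQuasiSymmetric {R : Type*} [CommRing R] {n : ℕ} (G : MvPolynomial (Fin n) R) : Prop :=
  MvPolynomial.rename (finRotate n) G = G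

/-- `f ∈ K[t]` is an `(n,q)`-quasi-symmetric polynomial if `f(t) = G(t, t^q, …, t^(q^(n-1)))`
for a quasi-symmetric polynomial `G` in `n` variables over `K`. -/
def IsNQQuasiSymmetric {K : Type*} [Field K] (n q : ℕ) (f : K[X]) : Prop :=
  ∃ G : MvPolynomial (Fin n) K, IsQuasiSymmetric G ∧
    f = MvPolynomial.aeval (fun j : Fin n => (X : K[X]) ^ q ^ (j : ℕ)) G

/-- All coefficients of `f` lie in the subfield `k` of `K`. -/
def HasCoeffsIn (k : Type*) {K : Type*} [Field k] [Field K] [Algebra k K] (f : K[X]) : Prop :=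
  ∀ m : ℕ, f.coeff m ∈ (algebraMap k K).range

/-- The `i`-th field `K(x 0, …, x i)` generated by a sequence `x` in an extension `Ω` of `K`. -/
noncomputable def stage (K : Type*) {Ω : Type*} [Field K] [Field Ω] [Algebra K Ω] (x : ℕ → Ω)
    (i : ℕ) : IntermediateField K Ω :=
  IntermediateField.adjoin K (x '' Set.Iic i)

theorem stage_mono (K : Type*) {Ω : Type*} [Field K] [Field Ω] [Algebra K Ω] (x : ℕ → Ω)
    {i j : ℕ} (hij : i ≤ j) : stage K x i ≤ stage K x j :=
  IntermediateField.adjoin.mono K _ _ (Set.image_mono (Set.Iic_subset_Iic.mpr hij))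

/-- The inclusion of the `i`-th field in the `j`-th field, for `i ≤ j`. -/
noncomputable def stageIncl (K : Type*) {Ω : Type*} [Field K] [Field Ω] [Algebra K Ω] (x : ℕ → Ω)
    {i j : ℕ} (hij : i ≤ j) : stage K x i →ₐ[K] stage K x j :=
  IntermediateField.inclusion (stage_mono K x hij)

/-- `x i` as an element of the `i`-th field. -/
noncomputable def stageGen (K : Type*) {Ω : Type*} [Field K] [Field Ω] [Algebra K Ω] (x : ℕ → Ω)
    (i : ℕ) : stage K x i :=
  ⟨x i, IntermediateField.subset_adjoin K _ (Set.mem_image_of_mem x (Set.mem_Iic.mpr le_rfl))⟩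

/-! Write `c = g(x_i)/h(x_i)` and `y = x_{i+1}`. Since the trace sum telescopes under Frobenius, `y`
satisfies `y^(q^n) - y = c^q - c`.

Splitting. Suppose `x_i` has residue `a ∈ K` at a place. Coefficients in `F_q` give `g(a)^q =
g(a^q)`, and quasi-symmetry gives `g(a^q) = g(a)`; likewise for `h`. So the residue `g(a)/h(a)` of
`c` is fixed by the `q`-th power, `c^q - c` lies in the maximal ideal, and `Y^|K| - Y - (c^q - c)`
reduces to the split separable polynomial `Y^|K| - Y`. The minimal polynomial of `y` divides it
integrally, so its reduction is also split and separable, and the place has as many extensions as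
the degree (`encard_comap_eq_of_splits`). The residue of `y` again lies in `K`, so the argument
repeats. It starts at any rational place other than the pole of `x_0`. Irreducibility of the trace
equation plays no role.

Extensions are counted directly: a valuation ring dominating a suitable ideal of `O[y]` realises
each root of the reduction, and comparison of coordinates in a Lagrange basis (`IsDualSystem.le`)
shows that a root determines its ring.

The pole. If `deg g = deg h + 1`, then `c` has the value of `x_i` at a pole, so `v(y)^(q^(n-1)) =
v(x_i)`. The terms of a polynomial in `y` of degree below `q^(n-1)` then have distinct values, and
every value is a power of `v(y)` with an exponent independent of the extension
(`IsPoleParameter.extend`). This gives at once uniqueness of the place, discreteness, and pole order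
one. -/

namespace ValuationSubring

/-! ### Extensions of a valuation ring with prescribed residue of an element -/

section Comap

variable {F F' : Type*} [Field F] [Field F'] [Algebra F F']
  {O : ValuationSubring F} {V : ValuationSubring F'}

theorem valuation_algebraMap_le_one_iff (h : V.comap (algebraMap F F') = O) (c : F) :
    V.valuation (algebraMap F F' c) ≤ 1 ↔ O.valuation c ≤ 1 := by
  subst h
  rw [valuation_le_one_iff, valuation_le_one_iff, mem_comap]

theorem valuation_algebraMap_lt_one_iff (h : V.comap (algebraMap F F') = O) (c : F) :
    V.valuation (algebraMap F F' c) < 1 ↔ O.valuation c < 1 := by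
  subst h
  rw [← mem_nonunits_iff, ← mem_nonunits_iff, mem_nonunits_iff_or, mem_nonunits_iff_or,
    mem_comap, map_inv₀, map_eq_zero]

theorem valuation_algebraMap_eq_one_iff (h : V.comap (algebraMap F F') = O) (c : F) :
    V.valuation (algebraMap F F' c) = 1 ↔ O.valuation c = 1 := by
  have h1 := valuation_algebraMap_le_one_iff h c
  have h2 := valuation_algebraMap_lt_one_iff h c
  rw [le_iff_lt_or_eq, le_iff_lt_or_eq] at h1
  constructor
  · intro e
    exact (h1.1 (Or.inr e)).resolve_left fun l => (h2.2 l).ne e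
  · intro e
    exact (h1.2 (Or.inr e)).resolve_left fun l => (h2.1 l).ne e

theorem comap_eq_of_dominates (h1 : ∀ c : F, O.valuation c ≤ 1 → V.valuation (algebraMap F F' c) ≤ 1)
    (h2 : ∀ c : F, O.valuation c < 1 → V.valuation (algebraMap F F' c) < 1) :
    V.comap (algebraMap F F') = O := by
  ext c
  rw [mem_comap, ← valuation_le_one_iff, ← valuation_le_one_iff]
  refine ⟨fun h => ?_, h1 c⟩
  by_contra hc
  have hc' : c⁻¹ ∈ O.nonunits := by
    rw [inv_mem_nonunits_iff, ← valuation_le_one_iff]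
    exact Or.inr hc
  have := h2 _ hc'
  rw [map_inv₀] at this
  have h3 : (algebraMap F F' c)⁻¹ ∈ V.nonunits := this
  rw [inv_mem_nonunits_iff, ← valuation_le_one_iff] at h3
  rcases h3 with h3 | h3
  · rw [map_eq_zero] at h3
    simp [h3] at hc
  · exact h3 h

/-- By `H`, evaluation at `r` modulo the maximal ideal factors through `O[y]`. Its kernel is
therefore a proper ideal of `O[y]`, containing `y - r` and the maximal ideal of `O`, and some
valuation ring of `F'` contains `O[y]` with that ideal among its nonunits. -/
theorem exists_comap_eq_and_sub_lt_one (O : ValuationSubring F) (y : F') (r : O)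
    (H : ∀ p : O[X], p.eval₂ ((algebraMap F F').comp O.subtype) y = 0 →
      p.eval r ∈ IsLocalRing.maximalIdeal O) :
    ∃ V : ValuationSubring F', V.comap (algebraMap F F') = O ∧
      V.valuation (y - algebraMap F F' r) < 1 := by
  set f : O[X] →+* F' := eval₂RingHom ((algebraMap F F').comp O.subtype) y with hf
  set J : Ideal O[X] := (IsLocalRing.maximalIdeal O).comap (evalRingHom r) with hJ
  have hne : J.map f.rangeRestrict ≠ ⊤ := by
    rw [Ne, Ideal.eq_top_iff_one,
      Ideal.mem_map_iff_of_surjective _ f.rangeRestrict_surjective]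
    rintro ⟨p, hp, hp1⟩
    have h0 : f (p - 1) = 0 := by
      have := congrArg Subtype.val hp1
      simp only [RingHom.coe_rangeRestrict] at this
      rw [map_sub, this, map_one]
      simp
    have h1 := H _ h0
    rw [eval_sub, eval_one] at h1
    have h2 : p.eval r ∈ IsLocalRing.maximalIdeal O := hp
    have h3 := sub_mem h2 h1
    rw [sub_sub_cancel] at h3
    exact (IsLocalRing.maximalIdeal.isMaximal O).ne_top ((Ideal.eq_top_iff_one _).2 h3)
  obtain ⟨V, hV1, hV2⟩ := Ideal.image_subset_nonunits_valuationSubring _ hne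
  have key1 : ∀ p, V.valuation (f p) ≤ 1 := fun p =>
    (valuation_le_one_iff _ _).2 (hV1 ⟨p, rfl⟩)
  have key2 : ∀ p, p.eval r ∈ IsLocalRing.maximalIdeal O → V.valuation (f p) < 1 := fun p hp =>
    hV2 ⟨f.rangeRestrict p, Ideal.mem_map_of_mem _ hp, rfl⟩
  refine ⟨V, comap_eq_of_dominates (fun c hc => ?_) fun c hc => ?_, ?_⟩
  · simpa [hf] using key1 (C ⟨c, (valuation_le_one_iff _ _).1 hc⟩)
  · have hc' : (⟨c, (valuation_le_one_iff _ _).1 hc.le⟩ : O) ∈ IsLocalRing.maximalIdeal O :=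
      (valuation_lt_one_iff _ _).2 hc
    simpa [hf] using key2 (C ⟨c, (valuation_le_one_iff _ _).1 hc.le⟩) (by simpa using hc')
  · have h := key2 (X - C r) (by simp)
    rw [hf, coe_eval₂RingHom, eval₂_sub, eval₂_X, eval₂_C] at h
    exact h

theorem exists_comap_eq (F' : Type*) [Field F'] [Algebra F F'] (O : ValuationSubring F) :
    ∃ V : ValuationSubring F', V.comap (algebraMap F F') = O := by
  -- For `y = 0`, `r = 0` the condition is automatic: a relation at `0` has zero constant
  -- coefficient.
  obtain ⟨V, hV, -⟩ := exists_comap_eq_and_sub_lt_one (F' := F') O 0 0 fun p hp => by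
    rw [eval₂_at_zero] at hp
    rw [← coeff_zero_eq_eval_zero]
    have : p.coeff 0 = 0 := by simpa using hp
    simp [this]
  exact ⟨V, hV⟩

end Comap

/-! ### Uniqueness of extensions through dual systems -/

section DualSystem

variable {F F' ι : Type*} [Field F] [Field F'] [Algebra F F']

/-- Valuation rings `V i` over `O` together with elements `e i` whose residues at `V j` are
given by the Kronecker symbol. -/
structure IsDualSystem (O : ValuationSubring F) (V : ι → ValuationSubring F') (e : ι → F') :
    Prop where
  comap_eq : ∀ i, (V i).comap (algebraMap F F') = O
  self : ∀ i, (V i).valuation (e i - 1) < 1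
  ne : ∀ i j, i ≠ j → (V i).valuation (e j) < 1

namespace IsDualSystem

variable {O : ValuationSubring F} {V V' : ι → ValuationSubring F'} {e : ι → F'}

theorem valuation_self (h : IsDualSystem O V e) (i : ι) : (V i).valuation (e i) = 1 := by
  have := (V i).valuation.map_one_add_of_lt (h.self i)
  rwa [add_sub_cancel] at this

theorem valuation_le_one (h : IsDualSystem O V e) (i j : ι) : (V i).valuation (e j) ≤ 1 := by
  by_cases hij : i = j
  · subst hij
    exact (h.valuation_self i).le
  · exact (h.ne i j hij).le

variable [Fintype ι]

theorem valuation_sum_sub_lt_one (h : IsDualSystem O V e) {c : ι → F}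
    (hc : ∀ i, O.valuation (c i) ≤ 1) (s : ι) :
    (V s).valuation (∑ i, algebraMap F F' (c i) * e i - algebraMap F F' (c s)) < 1 := by
  classical
  have hc' : ∀ i, (V s).valuation (algebraMap F F' (c i)) ≤ 1 := fun i =>
    (valuation_algebraMap_le_one_iff (h.comap_eq s) _).2 (hc i)
  have e1 : ∑ i, algebraMap F F' (c i) * e i - algebraMap F F' (c s) =
      ∑ i, algebraMap F F' (c i) * (e i - if s = i then 1 else 0) := by
    simp [mul_sub, Finset.sum_sub_distrib]
  rw [e1]
  refine Valuation.map_sum_lt _ one_ne_zero fun i _ => ?_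
  rw [map_mul, mul_comm]
  refine mul_lt_one_of_lt_of_le ?_ (hc' i)
  split_ifs with hs
  · subst hs
    exact h.self _
  · simpa using h.ne s i hs

/-- Divide by a coefficient `c j` of largest value. If that value exceeded 1, the normalised sum
would have residue 1 at `V j`, so the sum itself would have the value of `c j` there. -/
theorem coeff_integral (h : IsDualSystem O V e) {c : ι → F}
    (hc : ∀ s, (V s).valuation (∑ i, algebraMap F F' (c i) * e i) ≤ 1) (s : ι) :
    O.valuation (c s) ≤ 1 := by
  obtain ⟨j, -, hj⟩ := Finset.exists_max_image Finset.univ (fun i => O.valuation (c i))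
    ⟨s, Finset.mem_univ s⟩
  refine (hj s (Finset.mem_univ s)).trans ?_
  by_contra hlt
  rw [not_le] at hlt
  have h0 : c j ≠ 0 := by
    intro h0
    rw [h0, map_zero] at hlt
    exact not_lt_zero hlt
  have h1 := h.valuation_sum_sub_lt_one (c := fun i => c i / c j) (fun i => by
    rw [map_div₀]
    exact div_le_one_of_le₀ (hj i (Finset.mem_univ i)) zero_le) j
  have e1 : ∑ i, algebraMap F F' (c i / c j) * e i =
      (∑ i, algebraMap F F' (c i) * e i) / algebraMap F F' (c j) := by
    rw [Finset.sum_div]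
    refine Finset.sum_congr rfl fun i _ => ?_
    rw [map_div₀]
    ring
  rw [e1, div_self h0, map_one] at h1
  have h2 := (V j).valuation.map_one_add_of_lt h1
  rw [add_sub_cancel, map_div₀] at h2
  have h3 : ¬ (V j).valuation (algebraMap F F' (c j)) ≤ 1 := by
    rw [valuation_algebraMap_le_one_iff (h.comap_eq j)]
    exact not_le.2 hlt
  have h4 : (V j).valuation (algebraMap F F' (c j)) ≠ 0 := by simpa using h0
  rw [div_eq_one_iff_eq h4] at h2
  exact h3 (h2 ▸ hc j)

/-- An element `z` of `V s` is a quotient `(a * z) / a` with `a` and `a * z` integral at every `V i`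
and `a` a unit at `V s`. Both then have coordinates in `O`, and the residue of `a` is that of its
`s`-th coordinate. These facts involve only `O` and `e`, so they transfer to `V' s`. -/
theorem le (h : IsDualSystem O V e) (h' : IsDualSystem O V' e)
    (hspan : ∀ z : F', ∃ c : ι → F, z = ∑ i, algebraMap F F' (c i) * e i) (s : ι) :
    V s ≤ V' s := by
  classical
  intro z hz
  -- The element `t` has value below 1 where `z` is integral and value 1 elsewhere, so `1 + t * z`
  -- has value `max 1 (v z)` at each `V i`; its inverse is the required denominator.
  set T : Finset ι := Finset.univ.filter fun i => z ∉ V i with hT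
  set t : F' := ∑ i ∈ T, e i with ht
  have ht1 : ∀ i, z ∈ V i → (V i).valuation t < 1 := by
    intro i hi
    refine Valuation.map_sum_lt _ one_ne_zero fun j hj => h.ne i j ?_
    rintro rfl
    exact (Finset.mem_filter.1 hj).2 hi
  have ht2 : ∀ i, z ∉ V i → (V i).valuation t = 1 := by
    intro i hi
    have hiT : i ∈ T := Finset.mem_filter.2 ⟨Finset.mem_univ i, hi⟩
    rw [ht, ← Finset.add_sum_erase _ _ hiT, ← h.valuation_self i]
    refine Valuation.map_add_eq_of_lt_left _ ?_
    rw [h.valuation_self i]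
    refine Valuation.map_sum_lt _ one_ne_zero fun j hj => h.ne i j ?_
    exact fun e => (Finset.ne_of_mem_erase hj) e.symm
  have hu1 : ∀ i, z ∈ V i → (V i).valuation (1 + t * z) = 1 := by
    intro i hi
    refine Valuation.map_one_add_of_lt _ ?_
    rw [map_mul]
    exact mul_lt_one_of_lt_of_le (ht1 i hi) ((valuation_le_one_iff _ _).2 hi)
  have hu2 : ∀ i, z ∉ V i → (V i).valuation (1 + t * z) = (V i).valuation z := by
    intro i hi
    rw [← valuation_le_one_iff, not_le] at hi
    have e1 : (V i).valuation (t * z) = (V i).valuation z := by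
      rw [map_mul, ht2 i (by rw [← valuation_le_one_iff, not_le]; exact hi), one_mul]
    rw [← e1]
    exact Valuation.map_add_eq_of_lt_right _ (by rwa [map_one, e1])
  set a := (1 + t * z)⁻¹ with ha
  have haV : ∀ i, (V i).valuation a ≤ 1 := by
    intro i
    rw [ha, map_inv₀]
    by_cases hi : z ∈ V i
    · rw [hu1 i hi, inv_one]
    · rw [hu2 i hi]
      rw [← valuation_le_one_iff, not_le] at hi
      exact inv_le_one_of_one_le₀ hi.le
  have hazV : ∀ i, (V i).valuation (a * z) ≤ 1 := by
    intro i
    rw [ha, map_mul, map_inv₀]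
    by_cases hi : z ∈ V i
    · rw [hu1 i hi, inv_one, one_mul]
      exact (valuation_le_one_iff _ _).2 hi
    · rw [hu2 i hi]
      exact inv_mul_le_one
  obtain ⟨c, hc⟩ := hspan a
  obtain ⟨d, hd⟩ := hspan (a * z)
  have hcO := h.coeff_integral (c := c) (by rw [← hc]; exact haV)
  have hdO := h.coeff_integral (c := d) (by rw [← hd]; exact hazV)
  have hV'int : ∀ b : ι → F, (∀ i, O.valuation (b i) ≤ 1) →
      (V' s).valuation (∑ i, algebraMap F F' (b i) * e i) ≤ 1 := by
    intro b hb
    refine Valuation.map_sum_le _ fun i _ => ?_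
    rw [map_mul]
    exact mul_le_one' ((valuation_algebraMap_le_one_iff (h'.comap_eq s) _).2 (hb i))
      (h'.valuation_le_one s i)
  have hcs : O.valuation (c s) = 1 := by
    rw [← valuation_algebraMap_eq_one_iff (h.comap_eq s)]
    have h1 := h.valuation_sum_sub_lt_one hcO s
    rw [← hc, Valuation.map_sub_swap] at h1
    have h2 : (V s).valuation a = 1 := by rw [ha, map_inv₀, hu1 s hz, inv_one]
    have h3 := Valuation.map_add_eq_of_lt_right (V s).valuation (h1.trans_eq h2.symm)
    rwa [sub_add_cancel, h2] at h3
  have haV' : (V' s).valuation a = 1 := by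
    have h1 := h'.valuation_sum_sub_lt_one hcO s
    rw [← hc] at h1
    have h2 := (valuation_algebraMap_eq_one_iff (h'.comap_eq s) _).2 hcs
    have h3 := Valuation.map_add_eq_of_lt_right (V' s).valuation (h1.trans_eq h2.symm)
    rwa [sub_add_cancel, h2] at h3
  have h5 := hV'int d hdO
  rw [← hd, map_mul, haV', one_mul] at h5
  exact (valuation_le_one_iff _ _).1 h5

end IsDualSystem

end DualSystem

end ValuationSubring

/-! ### Values of polynomials with integral coefficients -/

theorem Valuation.eval₂_eq_pow {R F Γ : Type*} [Semiring R] [Field F]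
    [LinearOrderedCommGroupWithZero Γ] (v : Valuation F Γ) (f : R →+* F) {p : R[X]}
    (hp : ∀ i, v (f (p.coeff i)) ≤ 1) (hlead : v (f p.leadingCoeff) = 1) {y : F} (hy : 1 < v y) :
    v (p.eval₂ f y) = v y ^ p.natDegree := by
  rw [eval₂_eq_sum_range, Finset.sum_range_succ]
  have h1 : v (f (p.coeff p.natDegree) * y ^ p.natDegree) = v y ^ p.natDegree := by
    rw [map_mul, map_pow]
    erw [hlead]
    rw [one_mul]
  rw [← h1]
  refine Valuation.map_add_eq_of_lt_right _ ?_
  rw [h1]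
  have h0 : v y ^ p.natDegree ≠ 0 := pow_ne_zero _ (zero_lt_one.trans hy).ne'
  refine Valuation.map_sum_lt _ h0 fun i hi => ?_
  rw [map_mul, map_pow]
  calc v (f (p.coeff i)) * v y ^ i ≤ v y ^ i := mul_le_of_le_one_left' (hp i)
    _ < v y ^ p.natDegree := pow_lt_pow_right₀ hy (Finset.mem_range.1 hi)

theorem Valuation.eval₂_le_one {R F Γ : Type*} [Semiring R] [Field F]
    [LinearOrderedCommGroupWithZero Γ] (v : Valuation F Γ) (f : R →+* F) {p : R[X]} (hp : ∀ i, v (f (p.coeff i)) ≤ 1) {y : F} (hy : v y ≤ 1) :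
    v (p.eval₂ f y) ≤ 1 := by
  rw [eval₂_eq_sum_range]
  refine Valuation.map_sum_le _ fun i _ => ?_
  rw [map_mul, map_pow]
  exact mul_le_one' (hp i) (pow_le_one' hy i)

theorem Valuation.eval₂_lt_one {R F Γ : Type*} [Semiring R] [Field F]
    [LinearOrderedCommGroupWithZero Γ] (v : Valuation F Γ) (f : R →+* F) {p : R[X]}
    (hp : ∀ i, v (f (p.coeff i)) < 1) {y : F} (hy : v y ≤ 1) :
    v (p.eval₂ f y) < 1 := by
  rw [eval₂_eq_sum_range]
  refine Valuation.map_sum_lt _ one_ne_zero fun i _ => ?_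
  rw [map_mul, map_pow]
  exact mul_lt_one_of_lt_of_le (hp i) (pow_le_one' hy i)

/-! ### Counting extensions by the roots of a reduced minimal polynomial -/

namespace ValuationSubring

variable {F F' : Type*} [Field F] [Field F'] [Algebra F F']

/-- Gauss's lemma: a valuation ring is integrally closed, so a monic factor over `F` of a monic
polynomial over `O` has coefficients in `O`. -/
theorem exists_minpoly_lift {O : ValuationSubring F} {y : F'} {f : O[X]} (hf : f.Monic)
    (hfy : f.eval₂ ((algebraMap F F').comp O.subtype) y = 0) :
    ∃ M : O[X], M.Monic ∧ M.map O.subtype = minpoly F y ∧ M ∣ f := by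
  have hfy' : aeval y (f.map (algebraMap O F)) = 0 := by
    rw [aeval_def, eval₂_map]
    exact hfy
  have hint : IsIntegral F y := ⟨_, hf.map (algebraMap O F), hfy'⟩
  have hdvd := minpoly.dvd F y hfy'
  obtain ⟨M, hM⟩ := IsIntegrallyClosed.eq_map_mul_C_of_dvd F hf hdvd
  rw [(minpoly.monic hint).leadingCoeff, C_1, mul_one] at hM
  have hinj : Function.Injective (algebraMap O F) := IsFractionRing.injective O F
  have hMm : M.Monic := by
    refine monic_of_injective hinj ?_
    rw [hM]
    exact minpoly.monic hint
  refine ⟨M, hMm, hM, ?_⟩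
  rwa [← hM, map_dvd_map _ hinj hMm] at hdvd

variable {O : ValuationSubring F} {y : F'}

theorem valuation_le_one_of_eval₂_monic_eq_zero {W : ValuationSubring F'}
    (hW : W.comap (algebraMap F F') = O) {M : O[X]} (hM : M.Monic)
    (hMy : M.eval₂ ((algebraMap F F').comp O.subtype) y = 0) : W.valuation y ≤ 1 := by
  by_contra hlt
  rw [not_le] at hlt
  have h1 := Valuation.eval₂_eq_pow W.valuation ((algebraMap F F').comp O.subtype) (p := M)
    (fun i => (valuation_algebraMap_le_one_iff hW _).2 ((valuation_le_one_iff _ _).2 (M.coeff i).2))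
    (by rw [hM.leadingCoeff, map_one, map_one]) hlt
  rw [hMy, map_zero] at h1
  exact pow_ne_zero _ (zero_lt_one.trans hlt).ne' h1.symm

/-- At `W i` the element `y` has the residue of `r i`, and the differences of nodes are units, so
the Lagrange basis at `y` reduces to the Kronecker symbol. -/
theorem isDualSystem_lagrange {ι : Type*} [Fintype ι] [DecidableEq ι]
    {r : ι → O} (hr : Function.Injective fun i => IsLocalRing.residue O (r i))
    {W : ι → ValuationSubring F'} (hW : ∀ i, (W i).comap (algebraMap F F') = O)
    (hWy : ∀ i, (W i).valuation (y - algebraMap F F' (r i)) < 1) :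
    IsDualSystem O W fun i =>
      aeval y (Lagrange.basis Finset.univ (fun i => (r i : F)) i) := by
  have hunit : ∀ i j, i ≠ j → O.valuation ((r i : F) - r j) = 1 := by
    intro i j hij
    rcases O.valuation_lt_one_or_eq_one (r i - r j) with h | h
    · exfalso
      rw [← valuation_lt_one_iff, ← IsLocalRing.residue_eq_zero_iff, map_sub, sub_eq_zero] at h
      exact hij (hr h)
    · exact h
  have hinj : Function.Injective fun i => (r i : F) := fun i j h =>
    hr (congrArg (IsLocalRing.residue O) (Subtype.ext h))
  have hle : ∀ i t, (W i).valuation (y - algebraMap F F' (r t)) ≤ 1 := by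
    intro i t
    have e1 : y - algebraMap F F' (r t) =
        (y - algebraMap F F' (r i)) + algebraMap F F' ((r i - r t : O) : F) := by
      push_cast
      ring
    rw [e1]
    exact Valuation.map_add_le _ (hWy i).le ((valuation_algebraMap_le_one_iff (hW i) _).2
      ((valuation_le_one_iff _ _).2 (r i - r t).2))
  have hfac : ∀ i j t, j ≠ t → (W i).valuation
      (aeval y (Lagrange.basisDivisor (r j : F) (r t : F))) =
        (W i).valuation (y - algebraMap F F' (r t)) := by
    intro i j t hjt
    rw [Lagrange.basisDivisor, map_mul, aeval_C, map_mul,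
      (valuation_algebraMap_eq_one_iff (hW i) _).2 (by rw [map_inv₀, hunit j t hjt, inv_one]),
      one_mul, map_sub, aeval_X, aeval_C]
  have hne : ∀ i j, i ≠ j → (W i).valuation
      (aeval y (Lagrange.basis Finset.univ (fun i => (r i : F)) j)) < 1 := by
    intro i j hij
    have hi : i ∈ Finset.univ.erase j := Finset.mem_erase.2 ⟨hij, Finset.mem_univ i⟩
    rw [Lagrange.basis, map_prod, map_prod, ← Finset.mul_prod_erase _ _ hi, hfac i j i hij.symm]
    refine mul_lt_one_of_lt_of_le (hWy i) (Finset.prod_le_one' fun t ht => ?_)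
    rw [hfac i j t (Finset.ne_of_mem_erase (Finset.mem_of_mem_erase ht)).symm]
    exact hle i t
  refine ⟨hW, fun i => ?_, hne⟩
  -- The basis sums to 1, so the diagonal values follow from the off-diagonal ones.
  have h1 := congrArg (aeval y) (Lagrange.sum_basis (s := Finset.univ) hinj.injOn
    ⟨i, Finset.mem_univ i⟩)
  rw [map_sum, map_one, ← Finset.add_sum_erase _ _ (Finset.mem_univ i)] at h1
  rw [← h1, sub_add_cancel_left, Valuation.map_neg]
  exact Valuation.map_sum_lt _ one_ne_zero fun j hj => hne i j (Finset.ne_of_mem_erase hj).symm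

/-- If the minimal polynomial of a generator `y` is integral over the valuation ring `O` and its
reduction splits into distinct linear factors, then the number of extensions of `O` is the degree
of `y`. -/
theorem encard_comap_eq_of_splits (hgen : ∀ z : F', ∃ p : F[X], aeval y p = z)
    {M : O[X]} (hM : M.Monic) (hMy : M.map O.subtype = minpoly F y)
    (hsplit : (M.map (IsLocalRing.residue O)).Splits)
    (hsep : (M.map (IsLocalRing.residue O)).Separable) :
    {V : ValuationSubring F' | V.comap (algebraMap F F') = O}.encard = M.natDegree := by
  classical
  set S := (M.map (IsLocalRing.residue O)).roots.toFinset with hS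
  have hMS : M.map (IsLocalRing.residue O) = ∏ s : S, (X - C (s : IsLocalRing.ResidueField O)) := by
    rw [hsplit.eq_prod_roots_of_monic (hM.map _),
      Finset.prod_coe_sort S (fun s => X - C s), hS, Finset.prod,
      Multiset.toFinset_val, (nodup_roots hsep).dedup]
  have hcard : Fintype.card S = M.natDegree := by
    rw [← hM.natDegree_map (IsLocalRing.residue O), hMS, natDegree_prod_of_monic _ _
      fun s _ => monic_X_sub_C _]
    simp
  have hMy0 : M.eval₂ ((algebraMap F F').comp O.subtype) y = 0 := by
    rw [← eval₂_map, hMy]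
    exact minpoly.aeval F y
  have hint : IsIntegral F y := ⟨M.map O.subtype, hM.map _, by rw [eval₂_map]; exact hMy0⟩
  choose ρ hρ using IsLocalRing.residue_surjective (R := O)
  set r : S → O := fun s => ρ s with hr
  have hrinj : Function.Injective fun i => IsLocalRing.residue O (r i) := by
    intro i j hij
    simp only [hr, hρ] at hij
    exact Subtype.ext hij
  have hroot : ∀ s : S, M.eval (r s) ∈ IsLocalRing.maximalIdeal O := by
    intro s
    rw [← IsLocalRing.residue_eq_zero_iff, ← eval_map_apply, hr, hρ]
    exact (mem_roots'.1 (Multiset.mem_toFinset.1 s.2)).2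
  have hV : ∀ s : S, ∃ V : ValuationSubring F', V.comap (algebraMap F F') = O ∧
      V.valuation (y - algebraMap F F' (r s)) < 1 := by
    intro s
    refine exists_comap_eq_and_sub_lt_one O y (r s) fun p hp => ?_
    -- Every relation of `y` over `O` is a multiple of the monic `M`, whose value at `r s` lies in
    -- the maximal ideal.
    have hdvd : M ∣ p := by
      rw [← map_dvd_map O.subtype O.subtype_injective hM, hMy]
      refine minpoly.dvd _ _ ?_
      rw [aeval_def, eval₂_map]
      exact hp
    exact Ideal.mem_of_dvd _ (eval_dvd hdvd) (hroot s)
  choose V hVO hVy using hV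
  have hspan : ∀ z : F', ∃ c : S → F, z = ∑ i, algebraMap F F' (c i) *
      aeval y (Lagrange.basis Finset.univ (fun i => (r i : F)) i) := by
    intro z
    obtain ⟨p, rfl⟩ := hgen z
    have hinj : Function.Injective fun i => (r i : F) := fun i j h =>
      hrinj (congrArg (IsLocalRing.residue O) (Subtype.ext h))
    -- There are as many nodes as the degree of `y`, so interpolation recovers the remainder
    -- exactly.
    have hdeg : (p %ₘ minpoly F y).degree < (Finset.univ : Finset S).card := by
      refine (degree_modByMonic_lt p (minpoly.monic hint)).trans_eq ?_
      rw [← hMy, hM.degree_map, degree_eq_natDegree hM.ne_zero, ← hcard, Finset.card_univ]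
    refine ⟨fun i => (p %ₘ minpoly F y).eval (r i : F), ?_⟩
    have h1 := congrArg (aeval y) (Lagrange.eq_interpolate (s := Finset.univ) hinj.injOn hdeg)
    rw [← aeval_modByMonic_eq_self_of_root (minpoly.aeval F y), h1, Lagrange.interpolate_apply,
      map_sum]
    simp
  have huniq : ∀ (W : ValuationSubring F') (s : S), W.comap (algebraMap F F') = O →
      W.valuation (y - algebraMap F F' (r s)) < 1 → W = V s := by
    intro W s hW hWy
    have h1 := isDualSystem_lagrange hrinj hVO hVy
    -- Exchanging `V s` for `W` leaves a dual system for the same elements; comparison in both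
    -- directions gives `W = V s`.
    have h2 := isDualSystem_lagrange hrinj (W := Function.update V s W) (y := y)
      (fun i => by
        by_cases hi : i = s
        · subst hi; simpa using hW
        · simpa [Function.update_of_ne hi] using hVO i)
      (fun i => by
        by_cases hi : i = s
        · subst hi; rw [Function.update_self]; exact hWy
        · rw [Function.update_of_ne hi]; exact hVy i)
    have h3 := h1.le h2 hspan s
    have h4 := h2.le h1 hspan s
    rw [Function.update_self] at h3 h4
    exact le_antisymm h4 h3
  have hexists : ∀ W : ValuationSubring F', W.comap (algebraMap F F') = O →
      ∃ s : S, W.valuation (y - algebraMap F F' (r s)) < 1 := by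
    intro W hW
    -- `D` reduces to 0 and `M` kills `y`, so the product of the `y - r s` has value below 1 at `W`;
    -- hence so has some factor.
    set D : O[X] := ∏ s : S, (X - C (r s)) - M with hD
    have hDm : D.map (IsLocalRing.residue O) = 0 := by
      rw [hD, Polynomial.map_sub, hMS, Polynomial.map_prod, sub_eq_zero]
      simp [hr, hρ]
    have h1 : W.valuation (D.eval₂ ((algebraMap F F').comp O.subtype) y) < 1 := by
      refine Valuation.eval₂_lt_one _ _ (fun i => ?_)
        (valuation_le_one_of_eval₂_monic_eq_zero hW hM hMy0)
      refine (valuation_algebraMap_lt_one_iff hW _).2 ?_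
      refine (valuation_lt_one_iff _ _).1 ?_
      rw [← IsLocalRing.residue_eq_zero_iff, ← coeff_map, hDm, coeff_zero]
    rw [hD, eval₂_sub, hMy0, sub_zero, eval₂_finsetProd, map_prod] at h1
    by_contra! hcon
    refine absurd h1 (not_lt.2 (Finset.one_le_prod' fun s _ => ?_))
    rw [eval₂_sub, eval₂_X, eval₂_C]
    exact hcon s
  have hVinj : Function.Injective V := by
    intro s t hst
    have h1 := isDualSystem_lagrange hrinj hVO hVy
    by_contra hne
    have h2 := h1.ne s t hne
    rw [hst, h1.valuation_self t] at h2
    exact lt_irrefl _ h2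
  have hrange : {V : ValuationSubring F' | V.comap (algebraMap F F') = O} = Set.range V := by
    ext W
    constructor
    · intro hW
      obtain ⟨s, hs⟩ := hexists W hW
      exact ⟨s, (huniq W s hW hs).symm⟩
    · rintro ⟨s, rfl⟩
      exact hVO s
  rw [hrange, ← Set.image_univ, hVinj.encard_image, Set.encard_univ, ENat.card_eq_coe_fintype_card,
    hcard]

end ValuationSubring

theorem Algebra.finiteDimensional_and_finrank_of_aeval_surjective {F F' : Type*} [Field F] [Field F']
    [Algebra F F'] {y : F'} (hy : IsIntegral F y) (hgen : ∀ z : F', ∃ p : F[X], aeval y p = z) :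
    FiniteDimensional F F' ∧ Module.finrank F F' = (minpoly F y).natDegree := by
  have htop : IntermediateField.adjoin F {y} = ⊤ := by
    rw [_root_.eq_top_iff]
    rintro z -
    obtain ⟨p, rfl⟩ := hgen z
    exact IntermediateField.algebra_adjoin_le_adjoin F {y} (aeval_mem_adjoin_singleton F y)
  have h1 := IntermediateField.adjoin.finiteDimensional hy
  have h2 := IntermediateField.adjoin.finrank hy
  rw [htop] at h1 h2
  exact ⟨IntermediateField.topEquiv.toLinearEquiv.finiteDimensional,
    by rw [← h2, IntermediateField.finrank_top']⟩

/-! ### Complete splitting and residues in the constant field -/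

namespace Place

variable {K F F' F'' : Type*} [Field K] [Field F] [Field F'] [Field F'']
  [Algebra K F] [Algebra K F'] [Algebra K F'']

/-- The restriction of a place, along an embedding for which it stays nontrivial. -/
def restrict (φ : F →ₐ[K] F') (P' : Place K F') (h : P'.ring.comap φ.toRingHom ≠ ⊤) : Place K F where
  ring := P'.ring.comap φ.toRingHom
  algebraMap_mem a := by
    rw [ValuationSubring.mem_comap]
    simpa using P'.algebraMap_mem a
  ne_top := h

/-- A valuation ring over the ring of a place, as a place. -/
def ofComapEq (φ : F →ₐ[K] F') (P : Place K F) (V : ValuationSubring F')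
    (h : V.comap φ.toRingHom = P.ring) : Place K F' where
  ring := V
  algebraMap_mem a := by
    have := P.algebraMap_mem a
    rw [← h, ValuationSubring.mem_comap] at this
    simpa using this
  ne_top := by
    rintro rfl
    exact P.ne_top (h ▸ rfl)

theorem ring_injective : Function.Injective (ring : Place K F → ValuationSubring F) :=
  fun _ _ h => Place.ext h

theorem LiesOver.comp {φ : F →ₐ[K] F'} {ψ : F' →ₐ[K] F''} {P : Place K F} {P' : Place K F'}
    {P'' : Place K F''} (h' : LiesOver ψ P'' P') (h : LiesOver φ P' P) :
    LiesOver (ψ.comp φ) P'' P := by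
  unfold LiesOver at *
  rw [← h, ← h']
  rfl

theorem LiesOver.exists_between {φ : F →ₐ[K] F'} {ψ : F' →ₐ[K] F''} {P : Place K F}
    {P'' : Place K F''} (h : LiesOver (ψ.comp φ) P'' P) :
    ∃ P' : Place K F', LiesOver ψ P'' P' ∧ LiesOver φ P' P := by
  have h' : (P''.ring.comap ψ.toRingHom).comap φ.toRingHom = P.ring := h
  refine ⟨P''.restrict ψ ?_, rfl, h'⟩
  intro ht
  rw [ht] at h'
  exact P.ne_top (h' ▸ rfl)

theorem LiesOver.unique {φ : F →ₐ[K] F'} {P Q : Place K F} {P' : Place K F'}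
    (h : LiesOver φ P' P) (h' : LiesOver φ P' Q) : P = Q :=
  Place.ext (h.symm.trans h')

theorem encard_liesOver (φ : F →ₐ[K] F') (P : Place K F) :
    {P' : Place K F' | LiesOver φ P' P}.encard =
      {V : ValuationSubring F' | V.comap φ.toRingHom = P.ring}.encard := by
  rw [← ring_injective.encard_image]
  congr 1
  ext V
  constructor
  · rintro ⟨P', h, rfl⟩
    exact h
  · intro h
    exact ⟨ofComapEq φ P V h, h, rfl⟩

theorem valuation_algebraMap (P : Place K F) {a : K} (ha : a ≠ 0) :
    P.ring.valuation (algebraMap K F a) = 1 := by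
  refine le_antisymm ((ValuationSubring.valuation_le_one_iff _ _).2 (P.algebraMap_mem a)) ?_
  have h := (ValuationSubring.valuation_le_one_iff _ _).2 (P.algebraMap_mem a⁻¹)
  rw [map_inv₀, map_inv₀] at h
  exact (inv_le_one₀ (zero_lt_iff.2 (by simpa using ha))).1 h

theorem valuation_algebraMap_le_one (P : Place K F) (a : K) :
    P.ring.valuation (algebraMap K F a) ≤ 1 :=
  (ValuationSubring.valuation_le_one_iff _ _).2 (P.algebraMap_mem a)

/-- The places over `P` are the disjoint union of the fibres over the intermediate places, all of
size `[F'' : F']`, and degrees multiply. -/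
theorem SplitsCompletely.comp {φ : F →ₐ[K] F'} {ψ : F' →ₐ[K] F''} {P : Place K F}
    (h : P.SplitsCompletely φ)
    (h' : ∀ P' : Place K F', LiesOver φ P' P → P'.SplitsCompletely ψ) :
    P.SplitsCompletely (ψ.comp φ) := by
  let : Algebra F F' := φ.toRingHom.toAlgebra
  let : Algebra F' F'' := ψ.toRingHom.toAlgebra
  let : Algebra F F'' := (ψ.comp φ).toRingHom.toAlgebra
  have : IsScalarTower F F' F'' := IsScalarTower.of_algebraMap_eq fun _ => rfl
  obtain ⟨hfin, hcard⟩ := h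
  have hpos : 0 < Module.finrank F F' := Module.finrank_pos
  have hSfin : {P' : Place K F' | LiesOver φ P' P}.Finite := by
    rw [← Set.encard_lt_top_iff]
    exact lt_of_eq_of_lt hcard (ENat.natCast_lt_top _)
  -- Some intermediate place is needed to obtain finiteness of `F''` over `F'` from `h'`.
  have hne : {P' : Place K F' | LiesOver φ P' P}.Nonempty := by
    rw [← Set.encard_pos]
    exact lt_of_lt_of_eq (by exact_mod_cast hpos) hcard.symm
  obtain ⟨P₀, hP₀⟩ := hne
  have hfin' : FiniteDimensional F' F'' := (h' P₀ hP₀).1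
  refine ⟨FiniteDimensional.trans F F' F'', ?_⟩
  have hunion : {P'' : Place K F'' | LiesOver (ψ.comp φ) P'' P} =
      ⋃ P' ∈ hSfin.toFinset, {P'' : Place K F'' | LiesOver ψ P'' P'} := by
    ext P''
    simp only [Set.mem_ofPred_eq, Set.Finite.mem_toFinset, Set.mem_iUnion, exists_prop]
    constructor
    · intro h
      obtain ⟨P', h1, h2⟩ := h.exists_between
      exact ⟨P', h2, h1⟩
    · rintro ⟨P', h2, h1⟩
      exact h1.comp h2
  have hdisj : (hSfin.toFinset : Set (Place K F')).PairwiseDisjoint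
      fun P' => {P'' : Place K F'' | LiesOver ψ P'' P'} := by
    intro P' _ Q' _ hne
    rw [Function.onFun, Set.disjoint_left]
    exact fun P'' h1 h2 => hne (h1.unique h2)
  have hsum : ∀ T : Finset (Place K F'), (∀ P' ∈ T, LiesOver φ P' P) →
      (⋃ P' ∈ T, {P'' : Place K F'' | LiesOver ψ P'' P'}).encard =
        (T.card * Module.finrank F' F'' : ℕ) := by
    classical
    intro T
    induction T using Finset.induction_on with
    | empty => simp
    | insert Q T hQ ih =>
      intro hT
      rw [Finset.set_biUnion_insert, Set.encard_union_eq, ih fun P' hP' =>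
        hT P' (Finset.mem_insert_of_mem hP'), Finset.card_insert_of_notMem hQ, add_mul, one_mul,
        add_comm, Nat.cast_add]
      · congr 1
        exact (h' Q (hT Q (Finset.mem_insert_self Q T))).2
      · rw [Set.disjoint_left]
        intro P'' h1 h2
        simp only [Set.mem_iUnion, exists_prop] at h2
        obtain ⟨Q', hQ', h2⟩ := h2
        exact hQ (LiesOver.unique h1 h2 ▸ hQ')
  rw [hunion, hsum _ fun P' hP' => hSfin.mem_toFinset.1 hP', ← Module.finrank_mul_finrank F F' F'']
  congr 2
  rw [hSfin.encard_eq_coe_toFinset_card] at hcard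
  exact_mod_cast hcard

theorem splitsCompletely_id (P : Place K F) : P.SplitsCompletely (AlgHom.id K F) := by
  refine ⟨?_, ?_⟩
  · exact inferInstanceAs (FiniteDimensional F F)
  · have h1 : {P' : Place K F | LiesOver (AlgHom.id K F) P' P} = {P} := by
      ext P'
      exact ⟨fun h => Place.ext h, fun h => h ▸ rfl⟩
    rw [h1, Set.encard_singleton]
    exact_mod_cast (Module.finrank_self F).symm

/-- A place splits completely in a simple extension whose generator is a root of a monic
integral polynomial with split separable reduction. -/
theorem splitsCompletely_of_monic (φ : F →ₐ[K] F') (P : Place K F) {y : F'}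
    (hgen : ∀ z : F', ∃ p : F[X], p.eval₂ φ.toRingHom y = z) {f : P.ring[X]} (hf : f.Monic)
    (hfy : f.eval₂ (φ.toRingHom.comp P.ring.subtype) y = 0)
    (hsplit : (f.map (IsLocalRing.residue P.ring)).Splits)
    (hsep : (f.map (IsLocalRing.residue P.ring)).Separable) : P.SplitsCompletely φ := by
  let : Algebra F F' := φ.toRingHom.toAlgebra
  obtain ⟨M, hM, hMy, hMf⟩ := ValuationSubring.exists_minpoly_lift hf hfy
  -- The reduced minimal polynomial divides the reduction of `f`, hence is also split and separable.
  have hdvd := Polynomial.map_dvd (IsLocalRing.residue P.ring) hMf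
  have hint : IsIntegral F y :=
    ⟨f.map P.ring.subtype, hf.map _, by rw [eval₂_map]; exact hfy⟩
  have h1 := ValuationSubring.encard_comap_eq_of_splits hgen hM hMy
    (hsplit.of_dvd (hf.map _).ne_zero hdvd) (hsep.of_dvd hdvd)
  have h2 := Algebra.finiteDimensional_and_finrank_of_aeval_surjective hint hgen
  refine ⟨h2.1, ?_⟩
  rw [encard_liesOver, h2.2, ← hMy, hM.natDegree_map]
  exact h1

theorem separable_and_splits_X_pow_card_sub_X {L : Type*} [Field L] [Finite K] (ι : K →+* L) :
    (X ^ Nat.card K - X : L[X]).Separable ∧ (X ^ Nat.card K - X : L[X]).Splits := by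
  have := Fintype.ofFinite K
  rw [Nat.card_eq_fintype_card]
  have h : (X ^ Fintype.card K - X : L[X]) = (X ^ Fintype.card K - X : K[X]).map ι := by simp
  rw [h]
  refine ⟨Separable.map ?_, Splits.map ?_ ι⟩
  · rw [separable_def]
    have : derivative (X ^ Fintype.card K - X : K[X]) = -1 := by
      rw [derivative_sub, derivative_X, derivative_X_pow, FiniteField.cast_card_eq_zero K, C_0,
        zero_mul, zero_sub]
    rw [this]
    exact isCoprime_one_right.neg_right
  · rw [splits_iff_card_roots, FiniteField.roots_X_pow_card_sub_X,
      FiniteField.X_pow_card_sub_X_natDegree_eq K Fintype.one_lt_card]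
    rfl

theorem splitsCompletely_of_pow_card_sub [Finite K] (φ : F →ₐ[K] F') (P : Place K F) {y : F'}
    (hgen : ∀ z : F', ∃ p : F[X], p.eval₂ φ.toRingHom y = z) {d : F}
    (hd : P.ring.valuation d < 1) (hy : y ^ Nat.card K - y = φ d) : P.SplitsCompletely φ := by
  set d' : P.ring := ⟨d, (ValuationSubring.valuation_le_one_iff _ _).1 hd.le⟩ with hd'
  have hres : IsLocalRing.residue P.ring d' = 0 := by
    rw [IsLocalRing.residue_eq_zero_iff, ValuationSubring.valuation_lt_one_iff]
    exact hd
  have hmap : (X ^ Nat.card K - X - C d' : P.ring[X]).map (IsLocalRing.residue P.ring) =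
      X ^ Nat.card K - X := by
    simp [hres]
  have h := separable_and_splits_X_pow_card_sub_X P.residueMap
  refine splitsCompletely_of_monic φ P hgen (f := X ^ Nat.card K - X - C d') ?_ ?_ ?_ ?_
  · have h1 : (X + C d' : P.ring[X]).degree < (Nat.card K : WithBot ℕ) := by
      rw [degree_X_add_C]
      exact_mod_cast Finite.one_lt_card
    rw [sub_sub]
    exact monic_X_pow_sub h1
  · simp only [eval₂_sub, eval₂_X_pow, eval₂_X, eval₂_C]
    rw [hy]
    exact sub_self _
  · rw [hmap]
    exact h.2
  · rw [hmap]
    exact h.1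

/-- The residue of `z` at `P` lies in the constant field. -/
def HasConstResidue (P : Place K F) (z : F) : Prop :=
  ∃ a : K, P.ring.valuation (z - algebraMap K F a) < 1

/-- Since `y^|K| - y` is the product of the `y - a` over `a ∈ K`, some factor has value below 1. -/
theorem hasConstResidue_of_pow_card_sub [Finite K] (P : Place K F) {y : F}
    (hd : P.ring.valuation (y ^ Nat.card K - y) < 1) : P.HasConstResidue y := by
  have := Fintype.ofFinite K
  have h : (X ^ Nat.card K - X : K[X]) = ∏ a : K, (X - C a) := by
    have hs := (separable_and_splits_X_pow_card_sub_X (RingHom.id K)).2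
    rw [Nat.card_eq_fintype_card] at hs ⊢
    have hm : (X ^ Fintype.card K - X : K[X]).Monic := monic_X_pow_sub (by
      rw [degree_X]
      exact_mod_cast Fintype.one_lt_card)
    rw [hs.eq_prod_roots_of_monic hm, FiniteField.roots_X_pow_card_sub_X]
    rfl
  have h1 := congrArg (aeval y) h
  simp only [map_sub, map_pow, aeval_X, map_prod, aeval_C] at h1
  rw [h1, map_prod] at hd
  by_contra hcon
  refine absurd hd (not_lt.2 (Finset.one_le_prod' fun a _ => ?_))
  by_contra hlt
  exact hcon ⟨a, not_le.1 hlt⟩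

theorem IsRational.hasConstResidue {P : Place K F} (hP : P.IsRational) {z : F}
    (hz : ¬ P.IsPole z) : P.HasConstResidue z := by
  have hz' : z ∈ P.ring := not_not.1 hz
  let : Algebra K (IsLocalRing.ResidueField P.ring) := P.residueMap.toAlgebra
  have hfin : Module.finrank K (IsLocalRing.ResidueField P.ring) = 1 := hP
  have hbot := Subalgebra.bot_eq_top_of_finrank_eq_one hfin
  have hmem : IsLocalRing.residue P.ring ⟨z, hz'⟩ ∈
      (⊥ : Subalgebra K (IsLocalRing.ResidueField P.ring)) := by
    rw [hbot]
    trivial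
  obtain ⟨a, ha⟩ := Algebra.mem_bot.1 hmem
  refine ⟨a, ?_⟩
  have h0 : IsLocalRing.residue P.ring
      (⟨z, hz'⟩ - (⟨algebraMap K F a, P.algebraMap_mem a⟩ : P.ring)) = 0 := by
    rw [map_sub, sub_eq_zero, ← ha]
    rfl
  rw [IsLocalRing.residue_eq_zero_iff, ValuationSubring.valuation_lt_one_iff] at h0
  exact h0

theorem LiesOver.valuation_lt_one_iff {φ : F →ₐ[K] F'} {P : Place K F} {P' : Place K F'}
    (h : LiesOver φ P' P) (c : F) : P'.ring.valuation (φ c) < 1 ↔ P.ring.valuation c < 1 :=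
  letI : Algebra F F' := φ.toRingHom.toAlgebra
  ValuationSubring.valuation_algebraMap_lt_one_iff h c

theorem LiesOver.hasConstResidue {φ : F →ₐ[K] F'} {P : Place K F} {P' : Place K F'}
    (h : LiesOver φ P' P) {z : F} (hz : P.HasConstResidue z) : P'.HasConstResidue (φ z) := by
  obtain ⟨a, ha⟩ := hz
  refine ⟨a, ?_⟩
  rw [← h.valuation_lt_one_iff, map_sub, AlgHom.commutes] at ha
  exact ha

theorem valuation_aeval_sub_lt_one (P : Place K F) {z : F} {a : K}
    (ha : P.ring.valuation (z - algebraMap K F a) < 1) (p : K[X]) :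
    P.ring.valuation (aeval z p - algebraMap K F (p.eval a)) < 1 := by
  have hz : P.ring.valuation z ≤ 1 := by
    have h := Valuation.map_add_le _ ha.le (P.valuation_algebraMap_le_one a)
    rwa [sub_add_cancel] at h
  obtain ⟨s, hs⟩ := X_sub_C_dvd_sub_C_eval (a := a) (p := p)
  have h1 := congrArg (aeval z) hs
  simp only [map_sub, map_mul, aeval_X, aeval_C] at h1
  rw [h1, map_mul]
  exact mul_lt_one_of_lt_of_le ha (Valuation.eval₂_le_one _ _
    (fun i => P.valuation_algebraMap_le_one _) hz)

theorem valuation_pow_sub_lt_one (P : Place K F) {z : F} {a : K} {q : ℕ} (haq : a ^ q = a)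
    (ha : P.ring.valuation (z - algebraMap K F a) < 1) :
    P.ring.valuation (z ^ q - z) < 1 := by
  have h1 := P.valuation_aeval_sub_lt_one ha (X ^ q - X)
  simpa [haq] using h1

/-- The quotient has residue `g(a)/h(a)`, where `a` is the residue of `z`, and this is fixed by the
`q`-th power. -/
theorem valuation_aeval_div_aeval_pow_sub_lt_one (P : Place K F) {z : F} (hz : P.HasConstResidue z)
    {g h : K[X]} {q : ℕ} (hg : ∀ a : K, g.eval a ^ q = g.eval a)
    (hh : ∀ a : K, h.eval a ^ q = h.eval a) (hh0 : ∀ a : K, h.eval a ≠ 0) :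
    P.ring.valuation ((aeval z g / aeval z h) ^ q - aeval z g / aeval z h) < 1 := by
  obtain ⟨a, ha⟩ := hz
  refine P.valuation_pow_sub_lt_one (a := g.eval a / h.eval a) (by rw [div_pow, hg, hh]) ?_
  have hga := P.valuation_aeval_sub_lt_one ha g
  have hha := P.valuation_aeval_sub_lt_one ha h
  have h1 := P.valuation_algebraMap (hh0 a)
  have h2 : P.ring.valuation (aeval z h) = 1 := by
    have h3 := Valuation.map_add_eq_of_lt_right P.ring.valuation (hha.trans_eq h1.symm)
    rwa [sub_add_cancel, h1] at h3
  have hne : aeval z h ≠ 0 := by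
    intro h0
    rw [h0, map_zero] at h2
    exact zero_ne_one h2
  have hne' : algebraMap K F (h.eval a) ≠ 0 := by simpa using hh0 a
  have e1 : aeval z g / aeval z h - algebraMap K F (g.eval a / h.eval a) =
      ((aeval z g - algebraMap K F (g.eval a)) * algebraMap K F (h.eval a) -
        (aeval z h - algebraMap K F (h.eval a)) * algebraMap K F (g.eval a)) /
        (aeval z h * algebraMap K F (h.eval a)) := by
    rw [map_div₀]
    field_simp
    ring
  rw [e1, map_div₀, map_mul, h1, h2, mul_one, div_one]
  refine Valuation.map_sub_lt _ ?_ ?_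
  · rw [map_mul, h1, mul_one]
    exact hga
  · rw [map_mul]
    exact mul_lt_one_of_lt_of_le hha (P.valuation_algebraMap_le_one _)

end Place

/-! ### Frobenius identities for trace sums and quasi-symmetric polynomials -/

theorem pow_card_sum_pow_sub {k A : Type*} [Field k] [Finite k] [CommRing A] [Algebra k A]
    (y : A) (n : ℕ) :
    (∑ j ∈ Finset.range n, y ^ Nat.card k ^ j) ^ Nat.card k -
      ∑ j ∈ Finset.range n, y ^ Nat.card k ^ j = y ^ Nat.card k ^ n - y := by
  have := Fintype.ofFinite k
  rw [Nat.card_eq_fintype_card]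
  have h1 : (∑ j ∈ Finset.range n, y ^ Fintype.card k ^ j) ^ Fintype.card k =
      ∑ j ∈ Finset.range n, y ^ Fintype.card k ^ (j + 1) := by
    have h2 := map_sum (FiniteField.frobeniusAlgHom k A) (fun j => y ^ Fintype.card k ^ j)
      (Finset.range n)
    simp only [FiniteField.coe_frobeniusAlgHom] at h2
    rw [h2]
    exact Finset.sum_congr rfl fun j _ => by rw [← pow_mul, pow_succ]
  rw [h1, ← Finset.sum_sub_distrib, Finset.sum_range_sub (fun j => y ^ Fintype.card k ^ j)]
  simp

theorem HasCoeffsIn.eval_pow_card {k K : Type*} [Field k] [Finite k] [Field K] [Algebra k K]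
    {f : K[X]} (hf : HasCoeffsIn k f) (a : K) :
    f.eval a ^ Nat.card k = f.eval (a ^ Nat.card k) := by
  have := Fintype.ofFinite k
  rw [Nat.card_eq_fintype_card]
  have h2 := map_sum (FiniteField.frobeniusAlgHom k K) (fun i => f.coeff i * a ^ i)
      (Finset.range (f.natDegree + 1))
  simp only [FiniteField.coe_frobeniusAlgHom] at h2
  rw [eval_eq_sum_range, eval_eq_sum_range, h2]
  refine Finset.sum_congr rfl fun i _ => ?_
  obtain ⟨b, hb⟩ := hf i
  rw [mul_pow, ← hb, ← map_pow, FiniteField.pow_card, ← pow_mul, ← pow_mul, mul_comm i]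

/-- Replacing `a` by `a^q` shifts `(a, a^q, …, a^(q^(n-1)))` cyclically because `a^(q^n) = a`, and
`G` is invariant under the shift. -/
theorem IsNQQuasiSymmetric.eval_pow {K : Type*} [Field K] {n q : ℕ} {f : K[X]}
    (hn : 0 < n) (hf : IsNQQuasiSymmetric n q f) {a : K} (ha : a ^ q ^ n = a) :
    f.eval (a ^ q) = f.eval a := by
  obtain ⟨m, rfl⟩ := Nat.exists_eq_succ_of_ne_zero hn.ne'
  obtain ⟨G, hG, rfl⟩ := hf
  have key : ∀ b : K, eval b (MvPolynomial.aeval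
      (fun j : Fin (m + 1) => (X : K[X]) ^ q ^ (j : ℕ)) G) =
      MvPolynomial.aeval (fun j : Fin (m + 1) => b ^ q ^ (j : ℕ)) G := by
    intro b
    have h := MvPolynomial.comp_aeval_apply
      (fun j : Fin (m + 1) => (X : K[X]) ^ q ^ (j : ℕ)) (aeval b) G
    rw [coe_aeval_eq_eval] at h
    rw [h]
    simp
  rw [key, key]
  conv_rhs => rw [← (show MvPolynomial.rename (finRotate (m + 1)) G = G from hG)]
  rw [MvPolynomial.aeval_rename]
  congr 2
  funext j
  rw [Function.comp_apply, ← pow_mul, ← pow_succ']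
  rcases eq_or_ne j (Fin.last m) with rfl | hj
  · rw [finRotate_last]
    simpa using ha
  · rw [coe_finRotate_of_ne_last hj]

/-! ### The steps of the tower as simple extensions, and the trace polynomial -/

section Stage

variable {K Ω : Type*} [Field K] [Field Ω] [Algebra K Ω] (x : ℕ → Ω)

theorem stage_succ_exists_aeval {i : ℕ} (hint : IsIntegral (stage K x i) (x (i + 1))) {z : Ω}
    (hz : z ∈ stage K x (i + 1)) : ∃ p : (stage K x i)[X], aeval (x (i + 1)) p = z := by
  have hle : stage K x (i + 1) ≤
      (IntermediateField.adjoin (stage K x i) {x (i + 1)}).restrictScalars K := by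
    refine IntermediateField.adjoin_le_iff.2 ?_
    rintro _ ⟨j, hj, rfl⟩
    rw [SetLike.mem_coe, IntermediateField.mem_restrictScalars]
    rcases Nat.lt_or_eq_of_le (Set.mem_Iic.1 hj) with hj | hj
    · have hmem : x j ∈ stage K x i := IntermediateField.subset_adjoin K _
        (Set.mem_image_of_mem x (Set.mem_Iic.2 (Nat.lt_succ_iff.1 hj)))
      exact (IntermediateField.adjoin (stage K x i) {x (i + 1)}).algebraMap_mem ⟨x j, hmem⟩
    · rw [hj]
      exact IntermediateField.mem_adjoin_simple_self _ _
  have h1 := hle hz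
  rw [IntermediateField.mem_restrictScalars, ← IntermediateField.mem_toSubalgebra,
    IntermediateField.adjoin_simple_toSubalgebra_of_isAlgebraic hint.isAlgebraic,
    Algebra.adjoin_singleton_eq_range_aeval] at h1
  exact h1

theorem stageIncl_exists_eval₂ {i : ℕ} (hint : IsIntegral (stage K x i) (x (i + 1)))
    (z : stage K x (i + 1)) : ∃ p : (stage K x i)[X],
      p.eval₂ (stageIncl K x (Nat.le_succ i)).toRingHom (stageGen K x (i + 1)) = z := by
  obtain ⟨p, hp⟩ := stage_succ_exists_aeval x hint z.2
  refine ⟨p, Subtype.ext ?_⟩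
  have h := hom_eval₂ p (stageIncl K x (Nat.le_succ i)).toRingHom
    (algebraMap (stage K x (i + 1)) Ω) (stageGen K x (i + 1))
  rw [← hp, aeval_def]
  exact h

theorem stageIncl_comp {i j l : ℕ} (hij : i ≤ j) (hjl : j ≤ l) :
    (stageIncl K x hjl).comp (stageIncl K x hij) = stageIncl K x (hij.trans hjl) := rfl

theorem coe_aeval_stageGen (i : ℕ) (p : K[X]) :
    ((aeval (stageGen K x i) p : stage K x i) : Ω) = aeval (x i) p :=
  (aeval_algebraMap_apply Ω (stageGen K x i) p).symm

/-- The sum of Frobenius powers, as a polynomial. -/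
noncomputable def tracePoly (R : Type*) [CommRing R] (q n : ℕ) : R[X] :=
  ∑ j ∈ Finset.range n, X ^ q ^ j

theorem tracePoly_succ_monic_natDegree (R : Type*) [CommRing R] [Nontrivial R] {q : ℕ} (hq : 1 < q)
    (m : ℕ) : (tracePoly R q (m + 1)).Monic ∧ (tracePoly R q (m + 1)).natDegree = q ^ m := by
  have hdeg : ∀ m, (tracePoly R q m).degree < (q ^ m : ℕ) := by
    intro m
    refine (degree_sum_le _ _).trans_lt ?_
    rw [Finset.sup_lt_iff (WithBot.bot_lt_coe _)]
    intro j hj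
    rw [degree_X_pow]
    exact_mod_cast Nat.pow_lt_pow_right hq (Finset.mem_range.1 hj)
  have h : tracePoly R q (m + 1) = X ^ q ^ m + tracePoly R q m := by
    rw [tracePoly, Finset.sum_range_succ, add_comm]
    rfl
  rw [h]
  refine ⟨monic_X_pow_add (hdeg m), ?_⟩
  rw [natDegree_add_eq_left_of_degree_lt, natDegree_X_pow]
  rw [degree_X_pow]
  exact hdeg m

theorem tracePoly_eval₂ {R S : Type*} [CommRing R] [CommRing S] (f : R →+* S) (y : S) (q n : ℕ) :
    (tracePoly R q n).eval₂ f y = ∑ j ∈ Finset.range n, y ^ q ^ j := by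
  simp [tracePoly, eval₂_finsetSum]

theorem monic_tracePoly_sub_C {R : Type*} [CommRing R] [Nontrivial R] {q : ℕ} (hq : 1 < q)
    (m : ℕ) (c : R) : (tracePoly R q (m + 1) - C c).Monic ∧
      (tracePoly R q (m + 1) - C c).natDegree = q ^ m := by
  obtain ⟨h1, h2⟩ := tracePoly_succ_monic_natDegree R hq m
  refine ⟨h1.sub_of_left ?_, ?_⟩
  · rw [degree_eq_natDegree h1.ne_zero, h2]
    exact degree_C_le.trans_lt (by exact_mod_cast Nat.pow_pos (zero_lt_one.trans hq))
  · rw [natDegree_sub_C, h2]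

end Stage

/-! ### Pole parameters and total ramification -/

namespace ValuationSubring

variable {F : Type*} [Field F]

/-- The element `y` is a common pole of the valuation rings in `S`, and the value of each nonzero
element is a power of the value of `y` whose exponent is the same for all rings in `S`. -/
def IsPoleParameter (S : Set (ValuationSubring F)) (y : F) : Prop :=
  (∀ V ∈ S, 1 < V.valuation y) ∧
    ∀ z : F, z ≠ 0 → ∃ m : ℤ, ∀ V ∈ S, V.valuation z = V.valuation y ^ m

theorem IsPoleParameter.mono {S T : Set (ValuationSubring F)} {y : F} (h : IsPoleParameter S y)
    (hTS : T ⊆ S) : IsPoleParameter T y :=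
  ⟨fun V hV => h.1 V (hTS hV), fun z hz =>
    let ⟨m, hm⟩ := h.2 z hz
    ⟨m, fun V hV => hm V (hTS hV)⟩⟩

/-- Membership of `z` in a ring of `S` depends only on the sign of its exponent, which all rings of
`S` share. -/
theorem IsPoleParameter.subsingleton {S : Set (ValuationSubring F)} {y : F}
    (h : IsPoleParameter S y) : S.Subsingleton := by
  intro V hV W hW
  ext z
  rcases eq_or_ne z 0 with rfl | hz
  · exact ⟨fun _ => W.zero_mem, fun _ => V.zero_mem⟩
  obtain ⟨m, hm⟩ := h.2 z hz
  rw [← valuation_le_one_iff, ← valuation_le_one_iff, hm V hV, hm W hW,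
    zpow_le_one_iff_right₀ (h.1 V hV), zpow_le_one_iff_right₀ (h.1 W hW)]

theorem IsPoleParameter.ne_zero {V : ValuationSubring F} {y : F} (h : IsPoleParameter {V} y) :
    y ≠ 0 := by
  rintro rfl
  have := h.1 V rfl
  rw [map_zero] at this
  exact not_lt_zero this

theorem IsPoleParameter.inv_mem {V : ValuationSubring F} {y : F} (h : IsPoleParameter {V} y) :
    y⁻¹ ∈ V := by
  rw [← valuation_le_one_iff, map_inv₀]
  exact inv_le_one_of_one_le₀ (h.1 V rfl).le

theorem IsPoleParameter.exists_nat {V : ValuationSubring F} {y : F} (h : IsPoleParameter {V} y)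
    {a : V} (ha : a ≠ 0) : ∃ m : ℕ, V.valuation a = V.valuation y⁻¹ ^ m := by
  obtain ⟨m, hm⟩ := h.2 a (by simpa using ha)
  have h1 := hm V rfl
  have h2 := V.valuation_le_one a
  rw [h1, zpow_le_one_iff_right₀ (h.1 V rfl)] at h2
  obtain ⟨l, rfl⟩ : ∃ l : ℕ, m = -(l : ℤ) := ⟨m.natAbs, by omega⟩
  exact ⟨l, by rw [h1, map_inv₀, zpow_neg, zpow_natCast, inv_pow]⟩

/-- Nonzero elements of `V` have values `v(y⁻¹)^m` with `m` natural, so in a factorisation of `y⁻¹`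
the exponents add to 1 and one factor is a unit. -/
theorem IsPoleParameter.irreducible_inv {V : ValuationSubring F} {y : F}
    (h : IsPoleParameter {V} y) : Irreducible (⟨y⁻¹, h.inv_mem⟩ : V) := by
  have hlt : V.valuation y⁻¹ < 1 := by
    rw [map_inv₀]
    exact inv_lt_one_of_one_lt₀ (h.1 V rfl)
  have hpos : 0 < V.valuation y⁻¹ := by
    rw [zero_lt_iff]
    simpa using h.ne_zero
  refine ⟨fun hu => hlt.ne ((valuation_eq_one_iff _ _).1 hu), fun a b hab => ?_⟩
  have hab' : y⁻¹ = (a : F) * b := congrArg Subtype.val hab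
  have hy0 : y⁻¹ ≠ 0 := inv_ne_zero h.ne_zero
  have ha0 : a ≠ 0 := by
    rintro rfl
    simp [hy0] at hab'
  have hb0 : b ≠ 0 := by
    rintro rfl
    simp [hy0] at hab'
  obtain ⟨m, hm⟩ := h.exists_nat ha0
  obtain ⟨l, hl⟩ := h.exists_nat hb0
  have h1 := congrArg V.valuation hab'
  rw [map_mul, hm, hl, ← pow_add] at h1
  have h2 : 1 = m + l := by
    refine (pow_right_strictAnti₀ hpos hlt).injective ?_
    simpa using h1
  rw [valuation_eq_one_iff, valuation_eq_one_iff, hm, hl]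
  rcases Nat.eq_zero_or_pos m with rfl | hm0
  · exact Or.inl (pow_zero _)
  · obtain rfl : l = 0 := by omega
    exact Or.inr (pow_zero _)

theorem IsPoleParameter.isDiscreteValuationRing {V : ValuationSubring F} {y : F}
    (h : IsPoleParameter {V} y) : IsDiscreteValuationRing V := by
  refine IsDiscreteValuationRing.ofHasUnitMulPowIrreducibleFactorization
    ⟨_, h.irreducible_inv, fun {a} ha => ?_⟩
  obtain ⟨m, hm⟩ := h.exists_nat ha
  have hne : (y⁻¹) ^ m ≠ 0 := pow_ne_zero _ (inv_ne_zero h.ne_zero)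
  rw [← map_pow, valuation_eq_iff] at hm
  obtain ⟨u, hu⟩ := hm
  refine ⟨m, u, Subtype.ext ?_⟩
  rw [← hu, mul_comm]
  rfl

theorem valuation_algebraMap_eq_of_eq {F' : Type*} [Field F'] [Algebra F F']
    {O : ValuationSubring F} {V : ValuationSubring F'} (h : V.comap (algebraMap F F') = O)
    {a b : F} (hab : O.valuation a = O.valuation b) :
    V.valuation (algebraMap F F' a) = V.valuation (algebraMap F F' b) := by
  rcases eq_or_ne b 0 with rfl | hb
  · rw [map_zero, map_eq_zero] at hab
    rw [hab]
  · have hb' : O.valuation b ≠ 0 := by simpa using hb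
    have h1 : O.valuation (a / b) = 1 := by rw [map_div₀, hab, div_self hb']
    rw [← valuation_algebraMap_eq_one_iff h, map_div₀, map_div₀, div_eq_one_iff_eq] at h1
    · exact h1
    · simpa using hb

/-- Reduce `z` to a polynomial in `y` of degree below `N = deg f`. As `v(y)^N = v(w)`, a term with
coefficient of value `v(w)^m` in degree `j` has value `v(y)^(N * m + j)`. These exponents differ
modulo `N`, so the largest term gives the value of `z`; they are computed in `O`, hence agree for
all extensions. -/
theorem IsPoleParameter.extend {F' : Type*} [Field F'] [Algebra F F'] {O : ValuationSubring F}
    {w : F} (hw : IsPoleParameter {O} w) {y : F'} {f : F[X]} (hf : f.Monic)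
    (hfy : aeval y f = 0) (hgen : ∀ z : F', ∃ p : F[X], aeval y p = z)
    (hval : ∀ V : ValuationSubring F', V.comap (algebraMap F F') = O →
      V.valuation y ^ f.natDegree = V.valuation (algebraMap F F' w)) :
    IsPoleParameter {V : ValuationSubring F' | V.comap (algebraMap F F') = O} y := by
  set N := f.natDegree with hNdef
  have hone : ∀ V : ValuationSubring F', V.comap (algebraMap F F') = O → 1 < V.valuation y := by
    intro V hV
    have h1 : 1 < V.valuation (algebraMap F F' w) := by
      have := hw.1 O rfl
      rw [← not_le] at this ⊢
      rwa [valuation_algebraMap_le_one_iff hV]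
    rw [← hval V hV] at h1
    by_contra hle
    exact absurd (pow_le_one' (not_lt.1 hle) N) (not_le.2 h1)
  refine ⟨hone, fun z hz => ?_⟩
  obtain ⟨p, rfl⟩ := hgen z
  rw [← aeval_modByMonic_eq_self_of_root hfy] at hz ⊢
  set r := p %ₘ f with hr
  have hr0 : r ≠ 0 := by
    rintro h0
    rw [h0, map_zero] at hz
    exact hz rfl
  have hdeg : ∀ j ∈ r.support, j < N := by
    intro j hj
    have h1 := (le_degree_of_mem_supp j hj).trans_lt (degree_modByMonic_lt p hf)
    rw [degree_eq_natDegree hf.ne_zero] at h1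
    exact_mod_cast h1
  have hex : ∀ j, ∃ m : ℤ, j ∈ r.support → O.valuation (r.coeff j) = O.valuation w ^ m := by
    intro j
    by_cases hj : j ∈ r.support
    · obtain ⟨m, hm⟩ := hw.2 _ (mem_support_iff.1 hj)
      exact ⟨m, fun _ => hm O rfl⟩
    · exact ⟨0, fun h => absurd h hj⟩
  choose m hm using hex
  set E : ℕ → ℤ := fun j => N * m j + j with hE
  have hterm : ∀ V : ValuationSubring F', V.comap (algebraMap F F') = O → ∀ j ∈ r.support,
      V.valuation (algebraMap F F' (r.coeff j) * y ^ j) = V.valuation y ^ E j := by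
    intro V hV j hj
    have h1 := hm j hj
    rw [← map_zpow₀] at h1
    have hy0 : V.valuation y ≠ 0 := (zero_lt_one.trans (hone V hV)).ne'
    rw [map_mul, valuation_algebraMap_eq_of_eq hV h1, map_zpow₀, map_zpow₀, ← hval V hV, map_pow,
      hE, zpow_add₀ hy0, zpow_mul, zpow_natCast, zpow_natCast]
  have hinj : ∀ i ∈ r.support, ∀ j ∈ r.support, E i = E j → i = j := by
    intro i hi j hj hij
    have h1 : E i % N = i := by
      rw [hE, Int.mul_add_emod_self_left]
      exact Int.emod_eq_of_lt (by positivity) (by exact_mod_cast hdeg i hi)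
    have h2 : E j % N = j := by
      rw [hE, Int.mul_add_emod_self_left]
      exact Int.emod_eq_of_lt (by positivity) (by exact_mod_cast hdeg j hj)
    rw [hij, h2] at h1
    exact_mod_cast h1.symm
  obtain ⟨j₀, hj₀, hmax⟩ := Finset.exists_max_image r.support E (support_nonempty.2 hr0)
  refine ⟨E j₀, fun V hV => ?_⟩
  rw [aeval_eq_sum_range' (n := N) ?_ y]
  swap
  · by_cases h0 : r.natDegree ∈ r.support
    · exact hdeg _ h0
    · exact absurd (natDegree_mem_support_of_nonzero hr0) h0
  have hsub : r.support ⊆ Finset.range N := fun j hj => Finset.mem_range.2 (hdeg j hj)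
  rw [← Finset.sum_subset hsub (fun j _ hj => by rw [notMem_support_iff.1 hj, zero_smul])]
  simp only [Algebra.smul_def]
  rw [← hterm V hV j₀ hj₀]
  refine Valuation.map_sum_eq_of_lt _ (f := fun j => algebraMap F F' (r.coeff j) * y ^ j) hj₀
    fun j hj => ?_
  obtain ⟨hj1, hj2⟩ : j ∈ r.support ∧ j ≠ j₀ := by simpa using hj
  rw [hterm V hV j₀ hj₀, hterm V hV j hj1]
  refine zpow_lt_zpow_right₀ (hone V hV) (lt_of_le_of_ne (hmax j hj1) fun h => hj2 ?_)
  exact hinj j hj1 j₀ hj₀ h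

end ValuationSubring

/-! ### Places at a pole -/

namespace Place

variable {K F F' : Type*} [Field K] [Field F] [Field F'] [Algebra K F] [Algebra K F']

theorem hasOrd_neg_one {P : Place K F} {y : F}
    (h : ValuationSubring.IsPoleParameter {P.ring} y) : P.HasOrd y (-1) := by
  refine ⟨h.isDiscreteValuationRing, ⟨y⁻¹, h.inv_mem⟩, 1, h.irreducible_inv, isUnit_one, ?_⟩
  simp

theorem valuation_aeval_of_one_lt (P : Place K F) {y : F} (hy : 1 < P.ring.valuation y) {p : K[X]}
    (hp : p ≠ 0) : P.ring.valuation (aeval y p) = P.ring.valuation y ^ p.natDegree :=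
  Valuation.eval₂_eq_pow _ _ (fun _ => P.valuation_algebraMap_le_one _)
    (P.valuation_algebraMap (leadingCoeff_ne_zero.2 hp)) hy

theorem isPole_iff {P : Place K F} {y : F} : P.IsPole y ↔ 1 < P.ring.valuation y := by
  rw [IsPole, ← ValuationSubring.valuation_le_one_iff, not_le]

/-- At a pole of `y` a nonzero polynomial in `y` has the value of its leading term, so a quotient
has the difference of the degrees as exponent. -/
theorem isPoleParameter_of_frac {y : F}
    (hgen : ∀ z : F, ∃ p r : K[X], z = aeval y p / aeval y r) :
    ValuationSubring.IsPoleParameter {V | ∃ P : Place K F, P.IsPole y ∧ P.ring = V} y := by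
  refine ⟨?_, fun z hz => ?_⟩
  · rintro _ ⟨P, hP, rfl⟩
    exact isPole_iff.1 hP
  · obtain ⟨p, r, rfl⟩ := hgen z
    rw [div_ne_zero_iff] at hz
    have hp : p ≠ 0 := by
      rintro rfl
      exact hz.1 (map_zero _)
    have hr : r ≠ 0 := by
      rintro rfl
      exact hz.2 (map_zero _)
    refine ⟨p.natDegree - r.natDegree, ?_⟩
    rintro _ ⟨P, hP, rfl⟩
    have h1 := isPole_iff.1 hP
    rw [map_div₀, P.valuation_aeval_of_one_lt h1 hp, P.valuation_aeval_of_one_lt h1 hr,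
      zpow_sub₀ (zero_lt_one.trans h1).ne', zpow_natCast, zpow_natCast]

/-- In `K[y⁻¹]` the element `y⁻¹` is not a unit: an inverse `p(y⁻¹)` would force `X * p = 1` by
transcendence, which fails at 0. So some valuation ring has `y⁻¹` as a nonunit. -/
theorem exists_isPole {y : F} (hy : Transcendental K y) : ∃ P : Place K F, P.IsPole y := by
  have hy0 : y ≠ 0 := by
    rintro rfl
    exact hy isAlgebraic_zero
  set A := Algebra.adjoin K {y⁻¹} with hA
  have hmem : y⁻¹ ∈ A := Algebra.self_mem_adjoin_singleton K _
  have hne : Ideal.span {(⟨y⁻¹, hmem⟩ : A.toSubring)} ≠ ⊤ := by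
    rw [Ne, Ideal.span_singleton_eq_top, isUnit_iff_exists_inv]
    rintro ⟨⟨b, hb⟩, hab⟩
    have hb' : b ∈ A := hb
    rw [hA, Algebra.adjoin_singleton_eq_range_aeval] at hb'
    obtain ⟨p, rfl⟩ := hb'
    have h1 : y⁻¹ * aeval y⁻¹ p = 1 := congrArg Subtype.val hab
    have h2 : Transcendental K y⁻¹ := by
      rwa [Transcendental, IsAlgebraic.inv_iff]
    rw [transcendental_iff] at h2
    have h3 := h2 (X * p - 1) (by simp [h1])
    have h4 := congrArg (eval 0) h3
    simp at h4
  obtain ⟨V, hV1, hV2⟩ := Ideal.image_subset_nonunits_valuationSubring _ hne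
  have hyV : y⁻¹ ∈ V.nonunits := hV2 ⟨_, Ideal.subset_span rfl, rfl⟩
  rw [ValuationSubring.inv_mem_nonunits_iff] at hyV
  have hyV' := hyV.resolve_left hy0
  refine ⟨⟨V, fun a => hV1 (A.algebraMap_mem a), ?_⟩, hyV'⟩
  rintro rfl
  exact hyV' trivial

theorem exists_liesOver (φ : F →ₐ[K] F') (P : Place K F) : ∃ P' : Place K F', LiesOver φ P' P := by
  let : Algebra F F' := φ.toRingHom.toAlgebra
  obtain ⟨V, hV⟩ := ValuationSubring.exists_comap_eq F' P.ring
  exact ⟨ofComapEq φ P V hV, hV⟩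

/-- Integral `y` would make the trace sum integral, so `y` has a pole wherever `c` does; the leading
term then gives `v(y)^(q^(n-1)) = v(c) = v(w)`. -/
theorem isPoleParameter_of_sum_pow (φ : F →ₐ[K] F') (P : Place K F) {w c : F}
    (hw : ValuationSubring.IsPoleParameter {P.ring} w)
    (hc : P.ring.valuation c = P.ring.valuation w) {y : F'}
    (hgen : ∀ z : F', ∃ p : F[X], p.eval₂ φ.toRingHom y = z) {q n : ℕ} (hq : 1 < q) (hn : 0 < n)
    (hy : ∑ j ∈ Finset.range n, y ^ q ^ j = φ c) :
    ValuationSubring.IsPoleParameter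
      {V : ValuationSubring F' | V.comap φ.toRingHom = P.ring} y := by
  let : Algebra F F' := φ.toRingHom.toAlgebra
  obtain ⟨m, rfl⟩ := Nat.exists_eq_succ_of_ne_zero hn.ne'
  obtain ⟨hmonic, hdeg⟩ := monic_tracePoly_sub_C hq m c
  refine hw.extend hmonic ?_ hgen fun V hV => ?_
  · rw [aeval_def, eval₂_sub, tracePoly_eval₂, hy, eval₂_C]
    exact sub_self _
  · have h1 := ValuationSubring.valuation_algebraMap_eq_of_eq hV hc
    -- Taking the coefficients in `V` itself makes their integrality automatic.
    have hcy : (tracePoly V q (m + 1)).eval₂ V.subtype y = algebraMap F F' c := by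
      rw [tracePoly_eval₂, hy]
      rfl
    obtain ⟨hTm, hTd⟩ := tracePoly_succ_monic_natDegree V hq m
    have hcoeff : ∀ i, V.valuation (V.subtype ((tracePoly V q (m + 1)).coeff i)) ≤ 1 :=
      fun i => V.valuation_le_one _
    have h2 : 1 < V.valuation (algebraMap F F' c) := by
      have := hw.1 P.ring rfl
      rw [← hc] at this
      rw [← not_le] at this ⊢
      rwa [ValuationSubring.valuation_algebraMap_le_one_iff hV]
    have h3 : 1 < V.valuation y := by
      by_contra hle
      rw [← hcy] at h2
      exact absurd (Valuation.eval₂_le_one _ _ hcoeff (not_lt.1 hle)) (not_le.2 h2)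
    rw [← h1, ← hcy, Valuation.eval₂_eq_pow V.valuation V.subtype hcoeff
      (by rw [hTm.leadingCoeff, map_one, map_one]) h3, hdeg, hTd]

end Place

/-! ### Induction along the tower -/

section Tower

variable {K Ω : Type*} [Field K] [Field Ω] [Algebra K Ω] {x : ℕ → Ω} {q n : ℕ} {g h : ℕ → K[X]}

theorem sum_stageGen_pow
    (hx : ∀ i, ∑ j ∈ Finset.range n, x (i + 1) ^ q ^ j = aeval (x i) (g i) / aeval (x i) (h i))
    (i : ℕ) : ∑ j ∈ Finset.range n, stageGen K x (i + 1) ^ q ^ j =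
      stageIncl K x (Nat.le_succ i)
        (aeval (stageGen K x i) (g i) / aeval (stageGen K x i) (h i)) := by
  have h1 := hx i
  rw [← coe_aeval_stageGen, ← coe_aeval_stageGen] at h1
  refine Subtype.ext (Eq.trans ?_ h1)
  simp [stageGen]

theorem isIntegral_stage_succ (hq : 1 < q) (hn : 0 < n)
    (hx : ∀ i, ∑ j ∈ Finset.range n, x (i + 1) ^ q ^ j = aeval (x i) (g i) / aeval (x i) (h i))
    (i : ℕ) : IsIntegral (stage K x i) (x (i + 1)) := by
  obtain ⟨m, rfl⟩ := Nat.exists_eq_succ_of_ne_zero hn.ne'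
  refine ⟨tracePoly _ q (m + 1) -
    C (aeval (stageGen K x i) (g i) / aeval (stageGen K x i) (h i)),
    (monic_tracePoly_sub_C hq m _).1, ?_⟩
  rw [eval₂_sub, tracePoly_eval₂, hx, eval₂_C, ← coe_aeval_stageGen, ← coe_aeval_stageGen]
  exact sub_self _

theorem stageGen_zero_frac (z : stage K x 0) :
    ∃ p r : K[X], z = aeval (stageGen K x 0) p / aeval (stageGen K x 0) r := by
  have hset : x '' Set.Iic 0 = {x 0} := by
    ext w
    simp [eq_comm]
  have hz : (z : Ω) ∈ IntermediateField.adjoin K {x 0} := hset ▸ z.2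
  obtain ⟨p, r, hpr⟩ := IntermediateField.mem_adjoin_simple_iff K _ |>.1 hz
  refine ⟨p, r, Subtype.ext (hpr.trans ?_)⟩
  rw [← coe_aeval_stageGen, ← coe_aeval_stageGen]
  rfl

theorem transcendental_stageGen_zero (hx₀ : Transcendental K (x 0)) :
    Transcendental K (stageGen K x 0) := by
  rw [transcendental_iff] at hx₀ ⊢
  intro p hp
  refine hx₀ p ?_
  rw [← coe_aeval_stageGen, hp]
  rfl

theorem stageGen_pow_card_sub {k : Type*} [Field k] [Finite k] [Algebra k K]
    (hx : ∀ i, ∑ j ∈ Finset.range n, x (i + 1) ^ Nat.card k ^ j =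
      aeval (x i) (g i) / aeval (x i) (h i))
    (hcard : Nat.card K = Nat.card k ^ n) (i : ℕ) :
    stageGen K x (i + 1) ^ Nat.card K - stageGen K x (i + 1) =
      stageIncl K x (Nat.le_succ i)
        ((aeval (stageGen K x i) (g i) / aeval (stageGen K x i) (h i)) ^ Nat.card k -
          aeval (stageGen K x i) (g i) / aeval (stageGen K x i) (h i)) := by
  -- The `k`-algebra structure makes the `q`-power map additive on the stage.
  let : Algebra k (stage K x (i + 1)) :=
    ((algebraMap K (stage K x (i + 1))).comp (algebraMap k K)).toAlgebra
  rw [hcard, ← pow_card_sum_pow_sub, sum_stageGen_pow hx, map_sub, map_pow]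

theorem hasConstResidue_stageGen {k : Type*} [Field k] [Finite k] [Algebra k K] [Finite K]
    (hx : ∀ i, ∑ j ∈ Finset.range n, x (i + 1) ^ Nat.card k ^ j =
      aeval (x i) (g i) / aeval (x i) (h i))
    (hcard : Nat.card K = Nat.card k ^ n)
    (hg : ∀ i, ∀ a : K, (g i).eval a ^ Nat.card k = (g i).eval a)
    (hh : ∀ i, ∀ a : K, (h i).eval a ^ Nat.card k = (h i).eval a)
    (hzero : ∀ i, ∀ a : K, (h i).eval a ≠ 0)
    {P : Place K (stage K x 0)} (hP : P.HasConstResidue (stageGen K x 0)) (i : ℕ)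
    (Q : Place K (stage K x i)) (hQ : Place.LiesOver (stageIncl K x (Nat.zero_le i)) Q P) :
    Q.HasConstResidue (stageGen K x i) := by
  induction i with
  | zero => exact hQ.hasConstResidue hP
  | succ i ih =>
    obtain ⟨Q', h1, h2⟩ := Place.LiesOver.exists_between (φ := stageIncl K x (Nat.zero_le i))
      (ψ := stageIncl K x (Nat.le_succ i)) hQ
    refine Q.hasConstResidue_of_pow_card_sub ?_
    rw [stageGen_pow_card_sub hx hcard, h1.valuation_lt_one_iff]
    exact Q'.valuation_aeval_div_aeval_pow_sub_lt_one (ih Q' h2) (hg i) (hh i) (hzero i)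

theorem splitsCompletely_stage {k : Type*} [Field k] [Finite k] [Algebra k K] [Finite K]
    (hn : 0 < n)
    (hx : ∀ i, ∑ j ∈ Finset.range n, x (i + 1) ^ Nat.card k ^ j =
      aeval (x i) (g i) / aeval (x i) (h i))
    (hcard : Nat.card K = Nat.card k ^ n)
    (hg : ∀ i, ∀ a : K, (g i).eval a ^ Nat.card k = (g i).eval a)
    (hh : ∀ i, ∀ a : K, (h i).eval a ^ Nat.card k = (h i).eval a)
    (hzero : ∀ i, ∀ a : K, (h i).eval a ≠ 0)
    {P : Place K (stage K x 0)} (hP : P.HasConstResidue (stageGen K x 0)) {i j : ℕ} (hij : i ≤ j)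
    {Q : Place K (stage K x i)} (hQ : Place.LiesOver (stageIncl K x (Nat.zero_le i)) Q P) :
    Q.SplitsCompletely (stageIncl K x hij) := by
  induction j, hij using Nat.le_induction with
  | base => exact Q.splitsCompletely_id
  | succ j hij ih =>
    rw [← stageIncl_comp x hij (Nat.le_succ j)]
    refine ih.comp fun Q' hQ' => ?_
    have hres := hasConstResidue_stageGen hx hcard hg hh hzero hP j Q' (hQ'.comp hQ)
    exact Q'.splitsCompletely_of_pow_card_sub _
      (stageIncl_exists_eval₂ x (isIntegral_stage_succ Finite.one_lt_card hn hx j))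
      (Q'.valuation_aeval_div_aeval_pow_sub_lt_one hres (hg j) (hh j) (hzero j))
      (stageGen_pow_card_sub hx hcard j)

theorem exists_unique_place_over_pole (hq : 1 < q) (hn : 0 < n)
    (hx : ∀ i, ∑ j ∈ Finset.range n, x (i + 1) ^ q ^ j = aeval (x i) (g i) / aeval (x i) (h i))
    (hzero : ∀ i, h i ≠ 0) (hdeg : ∀ i, (g i).natDegree = (h i).natDegree + 1)
    {P : Place K (stage K x 0)}
    (hP : ValuationSubring.IsPoleParameter {P.ring} (stageGen K x 0)) (i : ℕ) :
    ∃ Q : Place K (stage K x i),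
      (∀ Q' : Place K (stage K x i),
        Place.LiesOver (stageIncl K x (Nat.zero_le i)) Q' P ↔ Q' = Q) ∧
      ValuationSubring.IsPoleParameter {Q.ring} (stageGen K x i) := by
  induction i with
  | zero => exact ⟨P, fun Q' => ⟨fun hQ' => Place.ext hQ', fun hQ' => hQ' ▸ rfl⟩, hP⟩
  | succ i ih =>
    obtain ⟨Q, hQ, hpar⟩ := ih
    have hpole := hpar.1 Q.ring rfl
    have hg0 : g i ≠ 0 := by
      intro h0
      have := hdeg i
      rw [h0, natDegree_zero] at this
      omega
    -- The degrees differ by one, so all but one factor `v(x_i)` cancel.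
    have hval : Q.ring.valuation
        (aeval (stageGen K x i) (g i) / aeval (stageGen K x i) (h i)) =
        Q.ring.valuation (stageGen K x i) := by
      rw [map_div₀, Q.valuation_aeval_of_one_lt hpole hg0,
        Q.valuation_aeval_of_one_lt hpole (hzero i), hdeg i, pow_succ', mul_div_assoc, div_self,
        mul_one]
      exact pow_ne_zero _ (zero_lt_one.trans hpole).ne'
    have hpar' := Place.isPoleParameter_of_sum_pow (stageIncl K x (Nat.le_succ i)) Q hpar hval
      (stageIncl_exists_eval₂ x (isIntegral_stage_succ hq hn hx i)) hq hn (sum_stageGen_pow hx i)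
    obtain ⟨R, hR⟩ := Place.exists_liesOver (stageIncl K x (Nat.le_succ i)) Q
    refine ⟨R, fun Q' => ⟨fun hQ' => ?_, ?_⟩, hpar'.mono (Set.singleton_subset_iff.2 hR)⟩
    · obtain ⟨Q'', h1, h2⟩ := Place.LiesOver.exists_between (φ := stageIncl K x (Nat.zero_le i))
        (ψ := stageIncl K x (Nat.le_succ i)) hQ'
      rw [hQ] at h2
      subst h2
      exact Place.ext (hpar'.subsingleton h1 hR)
    · rintro rfl
      exact hR.comp ((hQ Q).2 rfl)

end Tower

theorem mainTheorem6 {k K Ω : Type*} [Field k] [Finite k] [Field K] [Algebra k K]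
    [Field Ω] [Algebra K Ω] (q n : ℕ) (hq : Nat.card k = q) (hn : 1 < n)
    (hK : Module.finrank k K = n)
    (g h : ℕ → K[X])
    (hg : ∀ i, IsNQQuasiSymmetric n q (g i) ∧ HasCoeffsIn k (g i))
    (hh : ∀ i, IsNQQuasiSymmetric n q (h i) ∧ HasCoeffsIn k (h i))
    (hzero : ∀ i, ∀ a : K, (h i).eval a ≠ 0)
    (hdeg : ∀ i, (h i).natDegree < (g i).natDegree)
    (x : ℕ → Ω) (hx₀ : Transcendental K (x 0))
    (hx : ∀ i, ∑ j ∈ Finset.range n, x (i + 1) ^ q ^ j = aeval (x i) (g i) / aeval (x i) (h i)) :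
    ∃ Pinf : Place K (stage K x 0),
      (∀ P : Place K (stage K x 0), P.IsPole (stageGen K x 0) ↔ P = Pinf) ∧
      (∀ P : Place K (stage K x 0), P.IsRational → P ≠ Pinf →
        ∀ (i j : ℕ) (hij : i ≤ j) (Q : Place K (stage K x i)),
          Place.LiesOver (stageIncl K x (Nat.zero_le i)) Q P →
            Place.SplitsCompletely (stageIncl K x hij) Q) ∧
      ((∀ i, (g i).natDegree = (h i).natDegree + 1) →
        ∀ i : ℕ, ∃ Q : Place K (stage K x i),
          (∀ Q' : Place K (stage K x i),
            Place.LiesOver (stageIncl K x (Nat.zero_le i)) Q' Pinf ↔ Q' = Q) ∧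
          Q.HasOrd (stageGen K x i) (-1)) := by
  subst hq
  have hn0 : 0 < n := zero_lt_one.trans hn
  have : Module.Finite k K := Module.finite_of_finrank_pos (hK ▸ hn0)
  have : Finite K := Module.finite_of_finite k
  have hcard : Nat.card K = Nat.card k ^ n := by rw [Module.natCard_eq_pow_finrank (K := k), hK]
  have hfix : ∀ f : K[X], IsNQQuasiSymmetric n (Nat.card k) f ∧ HasCoeffsIn k f →
      ∀ a : K, f.eval a ^ Nat.card k = f.eval a := by
    intro f hf a
    rw [hf.2.eval_pow_card, hf.1.eval_pow hn0]
    have := Fintype.ofFinite K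
    rw [← hcard, Nat.card_eq_fintype_card, FiniteField.pow_card]
  obtain ⟨Pinf, hPinf⟩ := Place.exists_isPole (transcendental_stageGen_zero hx₀)
  have hpar := Place.isPoleParameter_of_frac (stageGen_zero_frac (K := K) (x := x))
  have huniq : ∀ P : Place K (stage K x 0), P.IsPole (stageGen K x 0) ↔ P = Pinf := fun P =>
    ⟨fun hP => Place.ext (hpar.subsingleton ⟨P, hP, rfl⟩ ⟨Pinf, hPinf, rfl⟩),
      fun hP => hP ▸ hPinf⟩
  refine ⟨Pinf, huniq, fun P hP hne i j hij Q hQ => ?_, fun hdeg' i => ?_⟩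
  · exact splitsCompletely_stage hn0 hx hcard (fun i => hfix _ (hg i)) (fun i => hfix _ (hh i))
      hzero (hP.hasConstResidue (mt (huniq P).1 hne)) hij hQ
  · obtain ⟨Q, h1, h2⟩ := exists_unique_place_over_pole Finite.one_lt_card hn0 hx
      (fun i h0 => hzero i 0 (by rw [h0, eval_zero])) hdeg'
      (hpar.mono (Set.singleton_subset_iff.2 ⟨Pinf, hPinf, rfl⟩)) i
    exact ⟨Q, h1, Place.hasOrd_neg_one h2⟩
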